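/- All graphs are finite and simple, and $\delta(G)$ is the minimum degree of $G$. For $s,t\ge 0$, an $(s,t)$-bipartite-hole in $G$ is a pair of disjoint sets $S,T\subseteq V(G)$ with $|S|=s$, $|T|=t$ and no edge of $G$ between $S$ and $T$. The bipartite-hole-number $\widetilde\alpha(G)$ is the least integer $r$ which may be written as $r=s+t-1$ for some positive integers $s,t$ such that $G$ does not contain an $(s,t)$-bipartite-hole. A certificate that $\widetilde\alpha(G)\ge k$ consists of pairs $(S_i,T_i)$ for $i=1,\dots,\lfloor k/2\rfloor$ such that $(S_i,T_i)$ is an $(i,k-i)$-bipartite-hole in $G$; a certificate that $\widetilde\alpha(G)>\delta(G)$ is one with $k=\delta(G)+1$. **Theorem.** There is an algorithm which, on input a graph $G$ with $n\ge 3$ vertices, in $O(n^3)$ time outputs either a Hamilton cycle of $G$ or a certificate that $\widetilde\alpha(G)>\delta(G)$ (so that, in the second case, indeed $\widetilde\alpha(G)>\delta(G)$). Here an algorithm is a single program for a word random access machine, with finitely many variables and arrays, the operations $+$, $\cdot$, truncated subtraction, comparison, and indirect read and write, composition, branching and loops, each elementary operation costing one unit of time. Words have $O(\log n)$ bits: for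 some constant $d$ fixed with the program, no value or address that occurs exceeds $n^d$. The graph has vertex set $\{0,\dots,n-1\}$ and is given by $n$ and its adjacency matrix. The output consists of a flag that says which of the two cases holds, and either the list of the vertices of the Hamilton cycle in cyclic order, or $k=\delta(G)+1$ and, for each $i=1,\dots,\lfloor k/2\rfloor$, lists of the elements of $S_i$ and $T_i$. -/

import Mathlib

/-! ### Bipartite holes -/

/-- `(S, T)` is an `(s, t)`-bipartite-hole of `G`. -/
def IsBipartiteHole {V : Type*} (G : SimpleGraph V) (s t : ℕ) (S T : Finset V) : Prop :=
  Disjoint S T ∧ S.card = s ∧ T.card = t ∧ ∀ u ∈ S, ∀ v ∈ T, ¬ G.Adj u v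

/-- The bipartite-hole-number: the least `r = s + t - 1`, with `s` and `t` positive, such that
`G` has no `(s, t)`-bipartite-hole. -/
noncomputable def bipartiteHoleNumber {V : Type*} (G : SimpleGraph V) : ℕ :=
  sInf {r | ∃ s t : ℕ, 0 < s ∧ 0 < t ∧ r + 1 = s + t ∧
    ¬ ∃ S T : Finset V, IsBipartiteHole G s t S T}

/-- A certificate that the bipartite-hole-number is at least `k`: pairs `(S i, T i)` for
`i = 1, …, ⌊k / 2⌋` that are `(i, k - i)`-bipartite-holes. -/
def IsHoleCertificate {V : Type*} (G : SimpleGraph V) (k : ℕ) (S T : ℕ → Finset V) : Prop :=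
  ∀ i, 1 ≤ i → i ≤ k / 2 → IsBipartiteHole G i (k - i) (S i) (T i)

/-! ### A word random access machine with a step count

A program is a structured (goto-free) program over finitely many integer variables and finitely
many one-dimensional arrays, both named by numerals in the program text. Every memory access,
arithmetic operation, comparison, assignment and branch costs one unit of time, and a program
gets stuck as soon as some value (hence also some address) exceeds the largest word `W`. -/

namespace RAM

/-- A memory: the values of the variables and the contents of the arrays. -/
structure Mem where
  var : ℕ → ℕ
  arr : ℕ → ℕ → ℕ

/-- Assign the value `v` to the variable `x`. -/
def Mem.setVar (m : Mem) (x v : ℕ) : Mem :=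
  { m with var := Function.update m.var x v }

/-- Write the value `v` to cell `i` of the array `a`. -/
def Mem.setArr (m : Mem) (a i v : ℕ) : Mem :=
  { m with arr := Function.update m.arr a (Function.update (m.arr a) i v) }

/-- Expressions. `sub` is truncated at `0`; the comparisons `lt` and `eq` return `1` or `0`. -/
inductive Exp where
  | lit (k : ℕ)
  | var (x : ℕ)
  | get (a : ℕ) (i : Exp)
  | add (e f : Exp)
  | sub (e f : Exp)
  | mul (e f : Exp)
  | lt (e f : Exp)
  | eq (e f : Exp)

/-- The value of an expression. -/
def Exp.eval (m : Mem) : Exp → ℕ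
  | .lit k => k
  | .var x => m.var x
  | .get a i => m.arr a (i.eval m)
  | .add e f => e.eval m + f.eval m
  | .sub e f => e.eval m - f.eval m
  | .mul e f => e.eval m * f.eval m
  | .lt e f => if e.eval m < f.eval m then 1 else 0
  | .eq e f => if e.eval m = f.eval m then 1 else 0

/-- The time to evaluate an expression: one unit for each of its nodes. -/
def Exp.cost : Exp → ℕ
  | .lit _ => 1
  | .var _ => 1
  | .get _ i => i.cost + 1
  | .add e f => e.cost + f.cost + 1
  | .sub e f => e.cost + f.cost + 1
  | .mul e f => e.cost + f.cost + 1
  | .lt e f => e.cost + f.cost + 1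
  | .eq e f => e.cost + f.cost + 1

/-- The expression and all its subexpressions have values at most `W`. -/
def Exp.Fits (W : ℕ) (m : Mem) : Exp → Prop
  | .lit k => k ≤ W
  | .var x => m.var x ≤ W
  | .get a i => i.Fits W m ∧ m.arr a (i.eval m) ≤ W
  | .add e f => e.Fits W m ∧ f.Fits W m ∧ e.eval m + f.eval m ≤ W
  | .sub e f => e.Fits W m ∧ f.Fits W m
  | .mul e f => e.Fits W m ∧ f.Fits W m ∧ e.eval m * f.eval m ≤ W
  | .lt e f => e.Fits W m ∧ f.Fits W m ∧ 1 ≤ W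
  | .eq e f => e.Fits W m ∧ f.Fits W m ∧ 1 ≤ W

/-- Programs. -/
inductive Cmd where
  | skip
  /-- assign the value of `e` to the variable `x` -/
  | assign (x : ℕ) (e : Exp)
  /-- write the value of `e` to the cell of the array `a` whose address is the value of `i` -/
  | store (a : ℕ) (i e : Exp)
  | seq (c d : Cmd)
  /-- execute `c` if the value of `e` is not `0`, and `d` otherwise -/
  | cond (e : Exp) (c d : Cmd)
  /-- execute `c` as long as the value of `e` is not `0` -/
  | loop (e : Exp) (c : Cmd)

/-- `Exec W c m t m'`: on words of size at most `W`, the program `c` started in the memory `m`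
halts after exactly `t` time units, and then the memory is `m'`. -/
inductive Exec (W : ℕ) : Cmd → Mem → ℕ → Mem → Prop where
  | skip (m : Mem) : Exec W .skip m 1 m
  | assign (m : Mem) (x : ℕ) (e : Exp) (he : e.Fits W m) :
      Exec W (.assign x e) m (e.cost + 1) (m.setVar x (e.eval m))
  | store (m : Mem) (a : ℕ) (i e : Exp) (hi : i.Fits W m) (he : e.Fits W m) :
      Exec W (.store a i e) m (i.cost + e.cost + 1) (m.setArr a (i.eval m) (e.eval m))
  | seq {c d : Cmd} {m m₁ m₂ : Mem} {t₁ t₂ : ℕ} (hc : Exec W c m t₁ m₁) (hd : Exec W d m₁ t₂ m₂) :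
      Exec W (.seq c d) m (t₁ + t₂) m₂
  | condTrue {e : Exp} {c : Cmd} (d : Cmd) {m m₁ : Mem} {t : ℕ} (he : e.Fits W m)
      (h : e.eval m ≠ 0) (hc : Exec W c m t m₁) :
      Exec W (.cond e c d) m (e.cost + 1 + t) m₁
  | condFalse {e : Exp} (c : Cmd) {d : Cmd} {m m₁ : Mem} {t : ℕ} (he : e.Fits W m)
      (h : e.eval m = 0) (hd : Exec W d m t m₁) :
      Exec W (.cond e c d) m (e.cost + 1 + t) m₁
  | loopTrue {e : Exp} {c : Cmd} {m m₁ m₂ : Mem} {t₁ t₂ : ℕ} (he : e.Fits W m)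
      (h : e.eval m ≠ 0) (hc : Exec W c m t₁ m₁) (hl : Exec W (.loop e c) m₁ t₂ m₂) :
      Exec W (.loop e c) m (e.cost + 1 + t₁ + t₂) m₂
  | loopFalse {e : Exp} (c : Cmd) {m : Mem} (he : e.Fits W m) (h : e.eval m = 0) :
      Exec W (.loop e c) m (e.cost + 1) m

/-- The machine is deterministic: the running time and the final memory are unique. -/
theorem Exec.unique {W : ℕ} {c : Cmd} {m m₁ m₂ : Mem} {t₁ t₂ : ℕ}
    (h₁ : Exec W c m t₁ m₁) (h₂ : Exec W c m t₂ m₂) : t₁ = t₂ ∧ m₁ = m₂ := by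
  induction h₁ generalizing t₂ m₂ with
  | skip => cases h₂; exact ⟨rfl, rfl⟩
  | assign => cases h₂; exact ⟨rfl, rfl⟩
  | store => cases h₂; exact ⟨rfl, rfl⟩
  | seq _ _ ihc ihd =>
    cases h₂ with
    | seq hc hd =>
      obtain ⟨rfl, rfl⟩ := ihc hc
      obtain ⟨rfl, rfl⟩ := ihd hd
      exact ⟨rfl, rfl⟩
  | condTrue _ _ h _ ih =>
    cases h₂ with
    | condTrue _ _ _ hc => obtain ⟨rfl, rfl⟩ := ih hc; exact ⟨rfl, rfl⟩
    | condFalse _ _ h' _ => exact absurd h' h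
  | condFalse _ _ h _ ih =>
    cases h₂ with
    | condTrue _ _ h' _ => exact absurd h h'
    | condFalse _ _ _ hd => obtain ⟨rfl, rfl⟩ := ih hd; exact ⟨rfl, rfl⟩
  | loopTrue _ h _ _ ihc ihl =>
    cases h₂ with
    | loopTrue _ _ hc hl =>
      obtain ⟨rfl, rfl⟩ := ihc hc
      obtain ⟨rfl, rfl⟩ := ihl hl
      exact ⟨rfl, rfl⟩
    | loopFalse _ _ h' => exact absurd h' h
  | loopFalse _ _ h =>
    cases h₂ with
    | loopTrue _ h' _ _ => exact absurd h h'
    | loopFalse => exact ⟨rfl, rfl⟩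

/-! ### Input and output of graph algorithms -/

/-- The initial memory for a graph on `{0, …, n - 1}`: variable `0` holds `n`, array `0` holds the
adjacency matrix row by row, and everything else is `0`. -/
def graphInput {n : ℕ} (G : SimpleGraph (Fin n)) [DecidableRel G.Adj] : Mem where
  var x := if x = 0 then n else 0
  arr a p := if a = 0 ∧ ∃ i j : Fin n, p = i * n + j ∧ G.Adj i j then 1 else 0

/-- Array `1` holds, in its cells `0, …, n - 1`, the successive vertices of a Hamilton cycle. -/
def HoldsHamiltonCycle {n : ℕ} (G : SimpleGraph (Fin n)) (m : Mem) : Prop :=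
  ∃ (a : Fin n) (p : G.Walk a a), p.IsHamiltonianCycle ∧
    ∀ i < n, m.arr 1 i = (p.getVert i : ℕ)

/-- Variable `1` holds `k`, and arrays `1` and `2` hold a certificate that the
bipartite-hole-number is at least `k`: for `1 ≤ i ≤ ⌊k / 2⌋`, the `i` vertices of `S i` are listed
in array `1`, and the `k - i` vertices of `T i` in array `2`, from the cell `i * n` on. -/
def HoldsHoleCertificate {n : ℕ} (G : SimpleGraph (Fin n)) (k : ℕ) (m : Mem) : Prop :=
  m.var 1 = k ∧ ∃ S T : ℕ → Finset (Fin n), IsHoleCertificate G k S T ∧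
    ∀ i, 1 ≤ i → i ≤ k / 2 →
      (S i).image Fin.val = (Finset.range i).image (fun j => m.arr 1 (i * n + j)) ∧
      (T i).image Fin.val = (Finset.range (k - i)).image (fun j => m.arr 2 (i * n + j))

end RAM

/-!
The algorithm keeps a cyclic order of the vertices and removes its *gaps*, the consecutive pairs
that are not adjacent; an order without gaps is a Hamilton cycle. Let `δ` be the minimum degree,
let `k = δ + 1`, and let `s` be the least number for which no `(s, k - s)`-bipartite-hole has been
found so far. As long as there is a gap and `2 * s ≤ k`, write the order as `f 0, …, f (n - 1)` with
a gap between `f (n - 1)` and `f 0`, and consider the positions `i` of the neighbours of `f 0` and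
the positions `j` of the neighbours of `f (n - 1)`; there are at least `δ = s + (k - s) - 1` of each.
Let `μ` be the `s`-th of the positions `i`.

* If `k - s` of the positions `j` are at least `μ`, take the predecessors `f (i - 1)` for `i ≤ μ`
  and the successors `f (j + 1)` for those `j`. An edge between them yields, after the reversal of the
  segments `0, …, i - 1` and `j + 1, …, n - 1`, an order with fewer gaps (`cycleGaps_exchange_le`).
* Otherwise `s` of the positions `j` are less than `μ`, and `k - s` of the positions `i` are at
  least `μ`. Take the predecessors `f (j - 1)` and `f (i - 1)` of these. An edge between them yields,
  after the reversal of the segments `j, …, i - 1` and `i, …, n - 1`, an order with fewer gaps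
  (`cycleGaps_exchange_lt`).

In both cases, if there is no edge then there is an `(s, k - s)`-bipartite-hole. A hole that has
been found remains one when the order changes, so each round, of time `O(n ^ 2)`, either lowers the
number of gaps or raises `s`, which happens at most `O(n)` times (`run_step`, `run_search`). The
search ends with a Hamilton cycle or with holes for all `s ≤ k / 2`, and these show that the
bipartite-hole-number is at least `k` (`IsHoleCertificate.le_bipartiteHoleNumber`).

The programs are verified in a program logic with a frame property: `Run W c m Q` says that `c`
halts from the memory `m` and that `Q` holds for its running time and its final memory.
-/

namespace RAM

/-! ### A program logic for the machine -/

@[simp] theorem Mem.setVar_var (m : Mem) (x v y : ℕ) :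
    (m.setVar x v).var y = if y = x then v else m.var y := by
  simp [Mem.setVar, Function.update_apply]

@[simp] theorem Mem.setVar_arr (m : Mem) (x v : ℕ) : (m.setVar x v).arr = m.arr := rfl

@[simp] theorem Mem.setArr_var (m : Mem) (a i v : ℕ) : (m.setArr a i v).var = m.var := rfl

@[simp] theorem Mem.setArr_arr (m : Mem) (a i v b : ℕ) :
    (m.setArr a i v).arr b = if b = a then Function.update (m.arr a) i v else m.arr b := by
  simp [Mem.setArr, Function.update_apply]

theorem Exp.lt_eval_ne_zero {e f : Exp} {m : Mem} :
    (Exp.lt e f).eval m ≠ 0 ↔ e.eval m < f.eval m := by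
  simp [Exp.eval]

theorem Exp.lt_eval_eq_zero {e f : Exp} {m : Mem} :
    (Exp.lt e f).eval m = 0 ↔ f.eval m ≤ e.eval m := by
  simp [Exp.eval]

theorem Exp.eq_eval_ne_zero {e f : Exp} {m : Mem} :
    (Exp.eq e f).eval m ≠ 0 ↔ e.eval m = f.eval m := by
  simp [Exp.eval]

theorem Exp.eq_eval_eq_zero {e f : Exp} {m : Mem} :
    (Exp.eq e f).eval m = 0 ↔ e.eval m ≠ f.eval m := by
  simp [Exp.eval]

/-- The program `c`, started in `m`, halts on words of size at most `W`, and its running time and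
final memory satisfy `Q`. -/
def Run (W : ℕ) (c : Cmd) (m : Mem) (Q : ℕ → Mem → Prop) : Prop :=
  ∃ t m', Exec W c m t m' ∧ Q t m'

/-- The variables that a program assigns to. -/
def Cmd.vars : Cmd → List ℕ
  | .skip => []
  | .assign x _ => [x]
  | .store _ _ _ => []
  | .seq c d => c.vars ++ d.vars
  | .cond _ c d => c.vars ++ d.vars
  | .loop _ c => c.vars

/-- The arrays that a program writes to. -/
def Cmd.arrs : Cmd → List ℕ
  | .skip => []
  | .assign _ _ => []
  | .store a _ _ => [a]
  | .seq c d => c.arrs ++ d.arrs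
  | .cond _ c d => c.arrs ++ d.arrs
  | .loop _ c => c.arrs

/-- `m'` agrees with `m` on all variables and arrays that `c` does not write to. -/
def Frame (c : Cmd) (m m' : Mem) : Prop :=
  (∀ x, x ∉ c.vars → m'.var x = m.var x) ∧ ∀ a, a ∉ c.arrs → m'.arr a = m.arr a

theorem Exec.frame {W : ℕ} {c : Cmd} {m m' : Mem} {t : ℕ} (h : Exec W c m t m') :
    Frame c m m' := by
  induction h with
  | skip => exact ⟨fun _ _ => rfl, fun _ _ => rfl⟩
  | assign m x e he =>
    refine ⟨fun y hy => ?_, fun _ _ => rfl⟩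
    have : y ≠ x := by simpa [Cmd.vars] using hy
    simp [this]
  | store m a i e hi he =>
    refine ⟨fun _ _ => rfl, fun b hb => ?_⟩
    have : b ≠ a := by simpa [Cmd.arrs] using hb
    simp [this]
  | seq _ _ ihc ihd =>
    refine ⟨fun y hy => ?_, fun b hb => ?_⟩
    · simp only [Cmd.vars, List.mem_append, not_or] at hy
      rw [ihd.1 y hy.2, ihc.1 y hy.1]
    · simp only [Cmd.arrs, List.mem_append, not_or] at hb
      rw [ihd.2 b hb.2, ihc.2 b hb.1]
  | condTrue _ _ _ _ ih =>
    refine ⟨fun y hy => ?_, fun b hb => ?_⟩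
    · simp only [Cmd.vars, List.mem_append, not_or] at hy
      exact ih.1 y hy.1
    · simp only [Cmd.arrs, List.mem_append, not_or] at hb
      exact ih.2 b hb.1
  | condFalse _ _ _ _ ih =>
    refine ⟨fun y hy => ?_, fun b hb => ?_⟩
    · simp only [Cmd.vars, List.mem_append, not_or] at hy
      exact ih.1 y hy.2
    · simp only [Cmd.arrs, List.mem_append, not_or] at hb
      exact ih.2 b hb.2
  | loopTrue _ _ _ _ ihc ihl =>
    exact ⟨fun y hy => (ihl.1 y hy).trans (ihc.1 y hy), fun b hb => (ihl.2 b hb).trans (ihc.2 b hb)⟩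
  | loopFalse => exact ⟨fun _ _ => rfl, fun _ _ => rfl⟩

section Run

variable {W : ℕ} {c d : Cmd} {e i : Exp} {m : Mem} {x a : ℕ} {Q Q' : ℕ → Mem → Prop}

theorem Run.mono (h : Run W c m Q) (hQ : ∀ t m', Frame c m m' → Q t m' → Q' t m') :
    Run W c m Q' := by
  obtain ⟨t, m', hE, hq⟩ := h
  exact ⟨t, m', hE, hQ t m' hE.frame hq⟩

theorem run_skip (h : Q 1 m) : Run W .skip m Q := ⟨1, m, .skip m, h⟩

theorem run_assign (he : e.Fits W m) (h : Q (e.cost + 1) (m.setVar x (e.eval m))) :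
    Run W (.assign x e) m Q := ⟨_, _, .assign m x e he, h⟩

theorem run_store (hi : i.Fits W m) (he : e.Fits W m)
    (h : Q (i.cost + e.cost + 1) (m.setArr a (i.eval m) (e.eval m))) :
    Run W (.store a i e) m Q := ⟨_, _, .store m a i e hi he, h⟩

theorem run_seq (h : Run W c m fun t₁ m₁ => Run W d m₁ fun t₂ m₂ => Q (t₁ + t₂) m₂) :
    Run W (.seq c d) m Q := by
  obtain ⟨t₁, m₁, hc, t₂, m₂, hd, hq⟩ := h
  exact ⟨_, _, .seq hc hd, hq⟩

theorem run_cond (he : e.Fits W m)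
    (h₁ : e.eval m ≠ 0 → Run W c m fun t m' => Q (e.cost + 1 + t) m')
    (h₂ : e.eval m = 0 → Run W d m fun t m' => Q (e.cost + 1 + t) m') :
    Run W (.cond e c d) m Q := by
  by_cases h : e.eval m = 0
  · obtain ⟨t, m', hd, hq⟩ := h₂ h
    exact ⟨_, _, .condFalse c he h hd, hq⟩
  · obtain ⟨t, m', hc, hq⟩ := h₁ h
    exact ⟨_, _, .condTrue d he h hc, hq⟩

/-- The rule for loops: `I v` is an invariant whose variant is bounded by `v`. -/
theorem run_loop {B : ℕ} (I : ℕ → Mem → Prop)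
    (hI : ∀ v m, I v m → e.Fits W m ∧
      (e.eval m ≠ 0 → Run W c m fun t m' => t ≤ B ∧ ∃ v' < v, I v' m')) (v : ℕ) :
    ∀ m, I v m → Run W (.loop e c) m fun t m' =>
      t ≤ (v + 1) * (B + e.cost + 1) ∧ e.eval m' = 0 ∧ ∃ v', I v' m' := by
  induction v using Nat.strong_induction_on with
  | _ v ih =>
    intro m hm
    obtain ⟨hf, hr⟩ := hI v m hm
    by_cases h : e.eval m = 0
    · exact ⟨_, _, .loopFalse c hf h, by nlinarith, h, v, hm⟩
    · obtain ⟨t₁, m₁, hE₁, ht₁, v', hv', hm₁⟩ := hr h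
      obtain ⟨t₂, m₂, hE₂, ht₂, h0, hm₂⟩ := ih v' hv' m₁ hm₁
      refine ⟨_, _, .loopTrue hf h hE₁ hE₂, ?_, h0, hm₂⟩
      have : (v' + 1) * (B + e.cost + 1) ≤ v * (B + e.cost + 1) := Nat.mul_le_mul_right _ hv'
      nlinarith

end Run

/-- Execute `c` for `x = 0, 1, …, N - 1`, where `N` is the value of the variable `y`. -/
def Cmd.for (x y : ℕ) (c : Cmd) : Cmd :=
  .seq (.assign x (.lit 0))
    (.loop (.lt (.var x) (.var y)) (.seq c (.assign x (.add (.var x) (.lit 1)))))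

theorem Cmd.for_vars (x y : ℕ) (c : Cmd) : (Cmd.for x y c).vars = x :: (c.vars ++ [x]) := rfl

theorem Cmd.for_arrs (x y : ℕ) (c : Cmd) : (Cmd.for x y c).arrs = c.arrs := by
  simp [Cmd.for, Cmd.arrs]

/-- The rule for counting loops: `I i` holds before the round with counter `i`. The frame passes on
to each round what the loop does not change, so `I` need only speak about what it changes. -/
theorem run_for {W N B x y : ℕ} {c : Cmd} {m₀ : Mem} (I : ℕ → Mem → Prop) (hN : N < W)
    (hy : m₀.var y = N) (hxy : y ≠ x) (hyc : y ∉ c.vars) (hxc : x ∉ c.vars)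
    (hI : ∀ i m v, I i m → I i (m.setVar x v)) (h0 : I 0 m₀)
    (hstep : ∀ i m, i < N → m.var x = i → Frame (Cmd.for x y c) m₀ m → I i m →
      Run W c m fun t m' => t ≤ B ∧ I (i + 1) m') :
    Run W (Cmd.for x y c) m₀ fun t m' => t ≤ N * (B + 8) + 8 ∧ I N m' := by
  have key : ∀ j i m, i + j = N → m.var x = i → Frame (Cmd.for x y c) m₀ m → I i m →
      Run W (.loop (.lt (.var x) (.var y)) (.seq c (.assign x (.add (.var x) (.lit 1))))) m
        fun t m' => t ≤ j * (B + 8) + 4 ∧ I N m' := by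
    intro j
    induction j with
    | zero =>
      intro i m hij hx hF hi
      have hym : m.var y = N := by rw [hF.1 y (by simp [Cmd.for_vars, hxy, hyc]), hy]
      refine ⟨_, _, .loopFalse _ ?_ ?_, ?_, ?_⟩
      · simp only [Exp.Fits]; omega
      · simp only [Exp.eval, hx, hym]; simp; omega
      · simp [Exp.cost]
      · have : i = N := by omega
        exact this ▸ hi
    | succ j ih =>
      intro i m hij hx hF hi
      have hym : m.var y = N := by rw [hF.1 y (by simp [Cmd.for_vars, hxy, hyc]), hy]
      obtain ⟨t₁, m₁, hE₁, ht₁, hI₁⟩ := hstep i m (by omega) hx hF hi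
      have hx₁ : m₁.var x = i := by rw [hE₁.frame.1 x hxc, hx]
      have hE₂ : Exec W (.assign x (.add (.var x) (.lit 1))) m₁ 4 (m₁.setVar x (i + 1)) := by
        have := Exec.assign (W := W) m₁ x (.add (.var x) (.lit 1))
          (by simp only [Exp.Fits, Exp.eval]; omega)
        simpa [Exp.cost, Exp.eval, hx₁] using this
      have hE := Exec.seq hE₁ hE₂
      obtain ⟨t₂, m₂, hE₃, ht₂, hI₂⟩ := ih (i + 1) (m₁.setVar x (i + 1)) (by omega) (by simp)
        (by
          have hF' := hE.frame
          constructor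
          · intro z hz
            rw [hF'.1 z, hF.1 z hz]
            simp only [Cmd.for_vars, List.mem_cons, not_or] at hz
            simpa [Cmd.vars] using hz.2
          · intro b hb
            rw [hF'.2 b, hF.2 b hb]
            rw [Cmd.for_arrs] at hb
            simpa [Cmd.arrs] using hb)
        (hI _ _ _ hI₁)
      refine ⟨_, _, .loopTrue ?_ ?_ hE hE₃, ?_, hI₂⟩
      · simp only [Exp.Fits]; omega
      · simp only [Exp.eval, hx, hym]; simp; omega
      · simp only [Exp.cost]; nlinarith
  refine run_seq (run_assign (by simp [Exp.Fits]) ?_)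
  refine (key N 0 (m₀.setVar x 0) (by omega) (by simp) ?_ (hI _ _ _ h0)).mono ?_
  · refine ⟨fun z hz => ?_, fun _ _ => rfl⟩
    have : z ≠ x := by
      simp only [Cmd.for_vars, List.mem_cons, not_or] at hz
      exact hz.1
    simp [this]
  · rintro t m' - ⟨ht, h⟩
    exact ⟨by simp only [Exp.cost]; omega, h⟩

end RAM

/-! ### Cyclic orders of the vertices and their gaps -/

/-- Adjacency of the vertices of a graph on `Fin n`, as a relation on the natural numbers. -/
def SimpleGraph.NatAdj {n : ℕ} (G : SimpleGraph (Fin n)) (u v : ℕ) : Prop :=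
  ∃ (hu : u < n) (hv : v < n), G.Adj ⟨u, hu⟩ ⟨v, hv⟩

theorem SimpleGraph.NatAdj.symm {n : ℕ} {G : SimpleGraph (Fin n)} {u v : ℕ}
    (h : G.NatAdj u v) : G.NatAdj v u :=
  let ⟨hu, hv, h⟩ := h
  ⟨hv, hu, h.symm⟩

theorem SimpleGraph.not_natAdj_self {n : ℕ} {G : SimpleGraph (Fin n)} {u : ℕ} :
    ¬ G.NatAdj u u := fun ⟨_, _, h⟩ => G.irrefl h

/-- `f 0, …, f (n - 1)` lists the numbers below `n`. The values of `f` from `n` on are irrelevant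
to the order, but have to be words of the machine. -/
structure IsOrdering (n : ℕ) (f : ℕ → ℕ) : Prop where
  lt : ∀ p, f p < n
  inj : ∀ p < n, ∀ q < n, f p = f q → p = q

/-- `f` with its values at `lo, …, hi` in reverse order. -/
def reverseSeg (f : ℕ → ℕ) (lo hi : ℕ) (p : ℕ) : ℕ :=
  if lo ≤ p ∧ p ≤ hi then f (lo + hi - p) else f p

theorem reverseSeg_of_mem {f : ℕ → ℕ} {lo hi p : ℕ} (h₁ : lo ≤ p) (h₂ : p ≤ hi) :
    reverseSeg f lo hi p = f (lo + hi - p) := if_pos ⟨h₁, h₂⟩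

theorem reverseSeg_of_lt {f : ℕ → ℕ} {lo hi p : ℕ} (h : p < lo) :
    reverseSeg f lo hi p = f p := if_neg (by omega)

theorem reverseSeg_of_gt {f : ℕ → ℕ} {lo hi p : ℕ} (h : hi < p) :
    reverseSeg f lo hi p = f p := if_neg (by omega)

theorem reverseSeg_of_le (f : ℕ → ℕ) {lo hi : ℕ} (h : hi ≤ lo) : reverseSeg f lo hi = f := by
  ext p
  unfold reverseSeg
  split
  · congr 1; omega
  · rfl

/-- Reversing a segment amounts to swapping its ends and reversing the rest. -/
theorem reverseSeg_swap (f : ℕ → ℕ) {lo hi : ℕ} (h : lo < hi) :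
    reverseSeg (Function.update (Function.update f lo (f hi)) hi (f lo)) (lo + 1) (hi - 1) =
      reverseSeg f lo hi := by
  ext p
  unfold reverseSeg
  simp only [Function.update_apply]
  grind

theorem IsOrdering.reverseSeg {n : ℕ} {f : ℕ → ℕ} (h : IsOrdering n f) {lo hi : ℕ} (hhi : hi < n) :
    IsOrdering n (reverseSeg f lo hi) := by
  constructor
  · intro p
    unfold _root_.reverseSeg
    split <;> exact h.lt _
  · intro p hp q hq hpq
    unfold _root_.reverseSeg at hpq
    split at hpq <;> split at hpq
    all_goals have := h.inj _ (by omega) _ (by omega) hpq; omega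

section Gaps

variable (R : ℕ → ℕ → Prop)

open Classical in
/-- `1` if `u` and `v` are not related, and `0` if they are. -/
noncomputable def gap (u v : ℕ) : ℕ := if R u v then 0 else 1

/-- The number of positions in `a, …, b - 1` at which `f` has consecutive unrelated values. -/
noncomputable def pathGaps (f : ℕ → ℕ) (a b : ℕ) : ℕ :=
  ∑ i ∈ Finset.Ico a b, gap R (f i) (f (i + 1))

/-- The number of unrelated consecutive pairs in the cyclic order `f 0, …, f (n - 1)`. -/
noncomputable def cycleGaps (n : ℕ) (f : ℕ → ℕ) : ℕ :=
  pathGaps R f 0 (n - 1) + gap R (f (n - 1)) (f 0)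

variable {R}

theorem gap_eq_zero {u v : ℕ} : gap R u v = 0 ↔ R u v := by
  unfold gap; split <;> simp_all

theorem gap_eq_one {u v : ℕ} (h : ¬ R u v) : gap R u v = 1 := if_neg h

theorem gap_le_one (u v : ℕ) : gap R u v ≤ 1 := by
  unfold gap; split <;> simp

theorem gap_comm (hR : ∀ u v, R u v → R v u) (u v : ℕ) : gap R u v = gap R v u := by
  by_cases h : R u v
  · rw [gap_eq_zero.2 h, gap_eq_zero.2 (hR _ _ h)]
  · rw [gap_eq_one h, gap_eq_one fun h' => h (hR _ _ h')]

theorem cycleGaps_le (n : ℕ) (hn : 0 < n) (f : ℕ → ℕ) : cycleGaps R n f ≤ n := by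
  have h₁ : pathGaps R f 0 (n - 1) ≤ n - 1 := by
    refine (Finset.sum_le_card_nsmul _ _ 1 fun i _ => gap_le_one _ _).trans ?_
    simp
  have h₂ := gap_le_one (R := R) (f (n - 1)) (f 0)
  unfold cycleGaps
  omega

theorem pathGaps_split (f : ℕ → ℕ) {a b c : ℕ} (hab : a ≤ b) (hbc : b < c) :
    pathGaps R f a c = pathGaps R f a b + gap R (f b) (f (b + 1)) + pathGaps R f (b + 1) c := by
  unfold pathGaps
  rw [← Finset.sum_Ico_consecutive _ hab hbc.le, Finset.sum_eq_sum_Ico_succ_bot hbc, add_assoc]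

theorem pathGaps_congr {f g : ℕ → ℕ} {a b : ℕ} (h : ∀ p, a ≤ p → p ≤ b → f p = g p) :
    pathGaps R f a b = pathGaps R g a b := by
  refine Finset.sum_congr rfl fun i hi => ?_
  rw [Finset.mem_Ico] at hi
  rw [h i hi.1 hi.2.le, h (i + 1) (by omega) hi.2]

theorem pathGaps_reverse (hR : ∀ u v, R u v → R v u) {f g : ℕ → ℕ} {a b : ℕ}
    (h : ∀ p, a ≤ p → p ≤ b → g p = f (a + b - p)) :
    pathGaps R g a b = pathGaps R f a b := by
  refine Finset.sum_nbij' (fun i => a + b - 1 - i) (fun i => a + b - 1 - i) ?_ ?_ ?_ ?_ ?_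
  · intro i hi; simp only [Finset.mem_Ico] at hi ⊢; omega
  · intro i hi; simp only [Finset.mem_Ico] at hi ⊢; omega
  · intro i hi; simp only [Finset.mem_Ico] at hi; omega
  · intro i hi; simp only [Finset.mem_Ico] at hi; omega
  · intro i hi
    simp only [Finset.mem_Ico] at hi
    rw [h i hi.1 hi.2.le, h (i + 1) (by omega) hi.2, gap_comm hR]
    congr 2 <;> omega

/-- Reversing both parts of a cyclic order that is cut in two reverses the cyclic order. -/
theorem cycleGaps_rotate (hR : ∀ u v, R u v → R v u) {n c : ℕ} (f : ℕ → ℕ) (hc : c < n) :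
    cycleGaps R n (reverseSeg (reverseSeg f 0 c) (c + 1) (n - 1)) = cycleGaps R n f := by
  set g := reverseSeg (reverseSeg f 0 c) (c + 1) (n - 1) with hg
  have g₁ : ∀ p, p ≤ c → g p = f (c - p) := fun p hp => by
    rw [hg, reverseSeg_of_lt (by omega), reverseSeg_of_mem (by omega) hp]; congr 1; omega
  have g₂ : ∀ p, c < p → p ≤ n - 1 → g p = f (c + 1 + (n - 1) - p) := fun p hp hp' => by
    rw [hg, reverseSeg_of_mem hp hp', reverseSeg_of_gt (by omega)]
  have e₁ : pathGaps R g 0 c = pathGaps R f 0 c :=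
    pathGaps_reverse hR fun p _ hp => by rw [g₁ p hp]; congr 1; omega
  unfold cycleGaps
  rcases Nat.lt_or_ge c (n - 1) with h | h
  · have e₂ : pathGaps R g (c + 1) (n - 1) = pathGaps R f (c + 1) (n - 1) :=
      pathGaps_reverse hR fun p hp hp' => by rw [g₂ p hp hp']
    rw [pathGaps_split g (Nat.zero_le c) h, pathGaps_split f (Nat.zero_le c) h, e₁, e₂,
      g₁ c le_rfl, g₂ (c + 1) (by omega) (by omega), g₂ (n - 1) (by omega) le_rfl, g₁ 0 (by omega),
      Nat.sub_self, Nat.sub_zero, show c + 1 + (n - 1) - (c + 1) = n - 1 by omega,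
      show c + 1 + (n - 1) - (n - 1) = c + 1 by omega, gap_comm hR (f 0), gap_comm hR (f (c + 1))]
    ring
  · obtain rfl : c = n - 1 := by omega
    rw [e₁, g₁ _ le_rfl, g₁ 0 (by omega), Nat.sub_self, Nat.sub_zero, gap_comm hR (f 0)]

/-- The exchange for neighbours `f i` of the first vertex and `f j` of the last, `i ≤ j`. -/
theorem cycleGaps_exchange_le (hR : ∀ u v, R u v → R v u) {n i j : ℕ} (f : ℕ → ℕ) (hi : 0 < i)
    (hij : i ≤ j) (hj : j < n - 1) (h : ¬ R (f (n - 1)) (f 0)) (h₁ : R (f 0) (f i))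
    (h₂ : R (f (n - 1)) (f j)) (h₃ : R (f (i - 1)) (f (j + 1))) :
    cycleGaps R n (reverseSeg (reverseSeg f 0 (i - 1)) (j + 1) (n - 1)) < cycleGaps R n f := by
  obtain ⟨i, rfl⟩ : ∃ i', i = i' + 1 := ⟨i - 1, by omega⟩
  rw [Nat.add_sub_cancel] at h₃ ⊢
  set g := reverseSeg (reverseSeg f 0 i) (j + 1) (n - 1) with hg
  have g₁ : ∀ p, p ≤ i → g p = f (i - p) := fun p hp => by
    rw [hg, reverseSeg_of_lt (by omega), reverseSeg_of_mem (by omega) hp]; congr 1; omega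
  have g₂ : ∀ p, i < p → p ≤ j → g p = f p := fun p hp hp' => by
    rw [hg, reverseSeg_of_lt (by omega), reverseSeg_of_gt hp]
  have g₃ : ∀ p, j < p → p ≤ n - 1 → g p = f (j + 1 + (n - 1) - p) := fun p hp hp' => by
    rw [hg, reverseSeg_of_mem hp hp', reverseSeg_of_gt (by omega)]
  have e₁ : pathGaps R g 0 i = pathGaps R f 0 i :=
    pathGaps_reverse hR fun p _ hp => by rw [g₁ p hp]; congr 1; omega
  have e₂ : pathGaps R g (i + 1) j = pathGaps R f (i + 1) j :=
    pathGaps_congr fun p hp hp' => g₂ p hp hp'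
  have e₃ : pathGaps R g (j + 1) (n - 1) = pathGaps R f (j + 1) (n - 1) :=
    pathGaps_reverse hR fun p hp hp' => g₃ p hp hp'
  unfold cycleGaps
  rw [pathGaps_split g (Nat.zero_le i) (show i < n - 1 by omega), pathGaps_split g hij hj,
    pathGaps_split f (Nat.zero_le i) (show i < n - 1 by omega), pathGaps_split f hij hj, e₁, e₂, e₃,
    g₁ i le_rfl, g₂ (i + 1) (by omega) hij, g₂ j (by omega) le_rfl,
    g₃ (j + 1) (by omega) (by omega), g₃ (n - 1) hj le_rfl, g₁ 0 (by omega), Nat.sub_self, Nat.sub_zero,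
    show j + 1 + (n - 1) - (j + 1) = n - 1 by omega,
    show j + 1 + (n - 1) - (n - 1) = j + 1 by omega, gap_eq_zero.2 h₁, gap_eq_zero.2 (hR _ _ h₂),
    gap_eq_zero.2 (hR _ _ h₃), gap_eq_one h]
  omega

/-- The exchange for neighbours `f i` of the first vertex and `f j` of the last, `j < i`. -/
theorem cycleGaps_exchange_lt (hR : ∀ u v, R u v → R v u) {n i j : ℕ} (f : ℕ → ℕ) (hj : 0 < j)
    (hij : j < i) (hi : i ≤ n - 1) (h : ¬ R (f (n - 1)) (f 0)) (h₁ : R (f 0) (f i))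
    (h₂ : R (f (n - 1)) (f j)) (h₃ : R (f (j - 1)) (f (i - 1))) :
    cycleGaps R n (reverseSeg (reverseSeg f j (i - 1)) i (n - 1)) < cycleGaps R n f := by
  obtain ⟨i, rfl⟩ : ∃ i', i = i' + 1 := ⟨i - 1, by omega⟩
  obtain ⟨j, rfl⟩ : ∃ j', j = j' + 1 := ⟨j - 1, by omega⟩
  rw [Nat.add_sub_cancel, Nat.add_sub_cancel] at h₃
  rw [Nat.add_sub_cancel]
  set g := reverseSeg (reverseSeg f (j + 1) i) (i + 1) (n - 1) with hg
  have g₁ : ∀ p, p ≤ j → g p = f p := fun p hp => by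
    rw [hg, reverseSeg_of_lt (by omega), reverseSeg_of_lt (by omega)]
  have g₂ : ∀ p, j < p → p ≤ i → g p = f (j + 1 + i - p) := fun p hp hp' => by
    rw [hg, reverseSeg_of_lt (by omega), reverseSeg_of_mem hp hp']
  have g₃ : ∀ p, i < p → p ≤ n - 1 → g p = f (i + 1 + (n - 1) - p) := fun p hp hp' => by
    rw [hg, reverseSeg_of_mem hp hp', reverseSeg_of_gt (by omega)]
  have e₁ : pathGaps R g 0 j = pathGaps R f 0 j :=
    pathGaps_congr fun p _ hp => g₁ p hp
  have e₂ : pathGaps R g (j + 1) i = pathGaps R f (j + 1) i :=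
    pathGaps_reverse hR fun p hp hp' => g₂ p hp hp'
  have e₃ : pathGaps R g (i + 1) (n - 1) = pathGaps R f (i + 1) (n - 1) :=
    pathGaps_reverse hR fun p hp hp' => g₃ p hp hp'
  have hi' : i < n - 1 := hi
  have hj' : j < n - 1 := by omega
  have hji : j + 1 ≤ i := by omega
  unfold cycleGaps
  rw [pathGaps_split g (Nat.zero_le j) hj', pathGaps_split g hji hi',
    pathGaps_split f (Nat.zero_le j) hj', pathGaps_split f hji hi', e₁, e₂, e₃,
    g₁ j le_rfl, g₂ (j + 1) (by omega) hji, g₂ i (by omega) le_rfl, g₃ (i + 1) (by omega) hi,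
    g₃ (n - 1) hi' le_rfl, g₁ 0 (by omega),
    show j + 1 + i - (j + 1) = i by omega, show j + 1 + i - i = j + 1 by omega,
    show i + 1 + (n - 1) - (i + 1) = n - 1 by omega,
    show i + 1 + (n - 1) - (n - 1) = i + 1 by omega, gap_eq_zero.2 (hR _ _ h₁),
    gap_eq_zero.2 (hR _ _ h₂), gap_eq_zero.2 h₃, gap_eq_one h]
  omega

end Gaps

/-! ### Hamilton cycles from orderings without gaps -/

theorem SimpleGraph.exists_walk_getVert_eq {V : Type*} {G : SimpleGraph V} (l : ℕ) (F : ℕ → V)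
    (h : ∀ i < l, G.Adj (F i) (F (i + 1))) :
    ∃ p : G.Walk (F 0) (F l), p.length = l ∧ ∀ i ≤ l, p.getVert i = F i := by
  induction l generalizing F with
  | zero => exact ⟨.nil, rfl, fun i hi => by rw [Nat.le_zero.1 hi]; rfl⟩
  | succ l ih =>
    obtain ⟨p, hl, hp⟩ := ih (fun i => F (i + 1)) fun i hi => h (i + 1) (by omega)
    refine ⟨.cons (h 0 (by omega)) p, by simp [hl], fun i hi => ?_⟩
    cases i with
    | zero => rfl
    | succ i => exact hp i (by omega)

theorem IsOrdering.exists_isHamiltonianCycle {n : ℕ} {G : SimpleGraph (Fin n)} {f : ℕ → ℕ}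
    (hn : 3 ≤ n) (hf : IsOrdering n f) (h : ∀ i < n, G.NatAdj (f i) (f ((i + 1) % n))) :
    ∃ (a : Fin n) (p : G.Walk a a), p.IsHamiltonianCycle ∧ ∀ i < n, f i = (p.getVert i : ℕ) := by
  let F : ℕ → Fin n := fun i => ⟨f (i % n), hf.lt _⟩
  have hF : F n = F 0 := by simp [F]
  obtain ⟨p, hl, hp⟩ := SimpleGraph.exists_walk_getVert_eq (G := G) n F fun i hi => by
    obtain ⟨_, _, h⟩ := h i hi
    simpa [F, Nat.mod_eq_of_lt hi] using h
  refine ⟨F 0, p.copy rfl hF, ?_, fun i hi => ?_⟩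
  · rw [SimpleGraph.Walk.isHamiltonianCycle_iff_isCycle_and_length_eq,
      SimpleGraph.Walk.isCycle_iff_isPath_tail_and_le_length]
    refine ⟨⟨?_, by simpa [hl] using hn⟩, by simpa using hl⟩
    rw [← SimpleGraph.Walk.IsPath.getVert_injOn_iff]
    have ht : (p.copy rfl hF).tail.length + 1 = n := by
      rw [SimpleGraph.Walk.length_tail_add_one]
      · simpa using hl
      · rw [SimpleGraph.Walk.not_nil_iff_lt_length]
        simp only [SimpleGraph.Walk.length_copy]
        omega
    intro i hi j hj hij
    simp only [Set.mem_ofPred_eq] at hi hj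
    rw [SimpleGraph.Walk.getVert_tail, SimpleGraph.Walk.getVert_tail,
      SimpleGraph.Walk.getVert_copy, SimpleGraph.Walk.getVert_copy, hp _ (by omega),
      hp _ (by omega), Fin.mk.injEq] at hij
    have key := hf.inj _ (Nat.mod_lt _ (by omega)) _ (Nat.mod_lt _ (by omega)) hij
    have hmod : ∀ i, i + 1 ≤ n → (i + 1) % n = if i + 1 = n then 0 else i + 1 := fun i hi => by
      split
      · next h => rw [h, Nat.mod_self]
      · exact Nat.mod_eq_of_lt (by omega)
    rw [hmod i (by omega), hmod j (by omega)] at key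
    split at key <;> split at key <;> omega
  · rw [SimpleGraph.Walk.getVert_copy, hp i hi.le]
    simp [F, Nat.mod_eq_of_lt hi]

/-- Counting the neighbours of `u` by position gives the degree. -/
theorem IsOrdering.card_filter_natAdj {n : ℕ} {G : SimpleGraph (Fin n)} [DecidableRel G.Adj]
    [DecidableRel G.NatAdj] {f : ℕ → ℕ} (hf : IsOrdering n f) (u : Fin n) :
    ((Finset.range n).filter fun p => G.NatAdj u (f p)).card = G.degree u := by
  have hbij : Function.Bijective fun p : Fin n => (⟨f p, hf.lt _⟩ : Fin n) :=
    Finite.injective_iff_bijective.1 fun p q hpq =>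
      Fin.ext (hf.inj p p.2 q q.2 (Fin.mk.inj_iff.1 hpq))
  rw [← SimpleGraph.card_neighborFinset_eq_degree]
  refine Finset.card_bij (fun p _ => ⟨f p, hf.lt _⟩) ?_ ?_ ?_
  · intro p hp
    obtain ⟨-, _, _, h⟩ := Finset.mem_filter.1 hp
    simpa using h
  · intro p hp q hq hpq
    exact hf.inj p (Finset.mem_range.1 (Finset.mem_filter.1 hp).1) q
      (Finset.mem_range.1 (Finset.mem_filter.1 hq).1) (Fin.mk.inj_iff.1 hpq)
  · intro v hv
    obtain ⟨p, rfl⟩ := hbij.2 v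
    exact ⟨p, Finset.mem_filter.2 ⟨Finset.mem_range.2 p.2, u.2, hf.lt _, by simpa using hv⟩, rfl⟩

/-! ### Certificates -/

theorem IsBipartiteHole.symm {V : Type*} {G : SimpleGraph V} {s t : ℕ} {S T : Finset V}
    (h : IsBipartiteHole G s t S T) : IsBipartiteHole G t s T S :=
  ⟨h.1.symm, h.2.2.1, h.2.1, fun u hu v hv huv => h.2.2.2 v hv u hu huv.symm⟩

theorem IsBipartiteHole.exists_of_le {V : Type*} {G : SimpleGraph V} {s t t' : ℕ} {S T : Finset V}
    (h : IsBipartiteHole G s t S T) (ht : t' ≤ t) :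
    ∃ T' : Finset V, IsBipartiteHole G s t' S T' := by
  obtain ⟨T', hT', hc⟩ := Finset.exists_subset_card_eq (h.2.2.1.symm ▸ ht : t' ≤ T.card)
  exact ⟨T', h.1.mono_right hT', h.2.1, hc, fun u hu v hv => h.2.2.2 u hu v (hT' hv)⟩

/-- If `(s, t)` were to witness a smaller bipartite-hole-number, then `s + t ≤ k`; the smaller one
of `s` and `t` is at most `k / 2`, and a part of the hole for it is an `(s, t)`-bipartite-hole. -/
theorem IsHoleCertificate.le_bipartiteHoleNumber {V : Type*} [Fintype V] {G : SimpleGraph V} {k : ℕ}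
    {S T : ℕ → Finset V} (h : IsHoleCertificate G k S T) : k ≤ bipartiteHoleNumber G := by
  have key : ∀ s t, 0 < s → s ≤ t → s + t ≤ k → ∃ S T : Finset V, IsBipartiteHole G s t S T :=
    fun s t hs hst hk => ⟨S s, (h s hs (by omega)).exists_of_le (by omega)⟩
  refine le_csInf ⟨Fintype.card V + 1, Fintype.card V + 1, 1, by omega, one_pos, by omega, ?_⟩ ?_
  · rintro ⟨S, T, -, hS, -⟩
    have := Finset.card_le_univ S
    omega
  · rintro r ⟨s, t, hs, ht, hr, hno⟩
    by_contra hk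
    apply hno
    rcases le_total s t with hst | hst
    · exact key s t hs hst (by omega)
    · obtain ⟨S, T, h⟩ := key t s ht hst (by omega)
      exact ⟨T, S, h.symm⟩

/-- The arrays `b₁` and `b₂` list the two sides of an `(i, k - i)`-bipartite-hole from the cell
`i * n` on. -/
def HoleStored {n : ℕ} (G : SimpleGraph (Fin n)) (k i : ℕ) (b₁ b₂ : ℕ → ℕ) : Prop :=
  ∃ S T : Finset (Fin n), IsBipartiteHole G i (k - i) S T ∧
    S.image Fin.val = (Finset.range i).image (fun j => b₁ (i * n + j)) ∧
    T.image Fin.val = (Finset.range (k - i)).image (fun j => b₂ (i * n + j))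

theorem exists_finset_image_val {n s : ℕ} {g : ℕ → ℕ} (hlt : ∀ x < s, g x < n)
    (hinj : ∀ x < s, ∀ y < s, g x = g y → x = y) :
    ∃ S : Finset (Fin n), S.card = s ∧ S.image Fin.val = (Finset.range s).image g := by
  have hmem : ∀ v ∈ (Finset.range s).image g, v < n := fun v hv => by
    obtain ⟨x, hx, rfl⟩ := Finset.mem_image.1 hv
    exact hlt x (Finset.mem_range.1 hx)
  have himg : (((Finset.range s).image g).attachFin hmem).image Fin.val =
      (Finset.range s).image g := by
    ext v
    simp only [Finset.mem_image (f := Fin.val), Finset.mem_attachFin]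
    exact ⟨fun ⟨w, hw, e⟩ => e ▸ hw, fun hv => ⟨⟨v, hmem v hv⟩, hv, rfl⟩⟩
  refine ⟨_, ?_, himg⟩
  rw [Finset.card_attachFin, Finset.card_image_of_injOn, Finset.card_range]
  intro x hx y hy
  simp only [Finset.coe_range, Set.mem_Iio] at hx hy
  exact hinj x hx y hy

theorem holeStored_of_not_natAdj {n : ℕ} {G : SimpleGraph (Fin n)} {k i : ℕ} {b₁ b₂ : ℕ → ℕ}
    (hlt₁ : ∀ x < i, b₁ (i * n + x) < n)
    (hinj₁ : ∀ x < i, ∀ y < i, b₁ (i * n + x) = b₁ (i * n + y) → x = y)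
    (hlt₂ : ∀ x < k - i, b₂ (i * n + x) < n)
    (hinj₂ : ∀ x < k - i, ∀ y < k - i, b₂ (i * n + x) = b₂ (i * n + y) → x = y)
    (hne : ∀ x < i, ∀ y < k - i, b₁ (i * n + x) ≠ b₂ (i * n + y))
    (hadj : ∀ x < i, ∀ y < k - i, ¬ G.NatAdj (b₁ (i * n + x)) (b₂ (i * n + y))) :
    HoleStored G k i b₁ b₂ := by
  obtain ⟨S, hcS, hS⟩ := exists_finset_image_val hlt₁ hinj₁
  obtain ⟨T, hcT, hT⟩ := exists_finset_image_val hlt₂ hinj₂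
  have memS : ∀ u ∈ S, ∃ x < i, b₁ (i * n + x) = u := fun u hu => by
    have := Finset.mem_image_of_mem Fin.val hu
    rw [hS] at this
    simpa using this
  have memT : ∀ v ∈ T, ∃ y < k - i, b₂ (i * n + y) = v := fun v hv => by
    have := Finset.mem_image_of_mem Fin.val hv
    rw [hT] at this
    simpa using this
  refine ⟨S, T, ⟨?_, hcS, hcT, fun u hu v hv huv => ?_⟩, hS, hT⟩
  · rw [Finset.disjoint_left]
    intro u hu hv
    obtain ⟨x, hx, hxu⟩ := memS u hu
    obtain ⟨y, hy, hyv⟩ := memT u hv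
    exact hne x hx y hy (hxu.trans hyv.symm)
  · obtain ⟨x, hx, hxu⟩ := memS u hu
    obtain ⟨y, hy, hyv⟩ := memT v hv
    exact hadj x hx y hy (hxu ▸ hyv ▸ ⟨u.2, v.2, huv⟩)

/-- Writing to the cells from `s * n` on does not affect the holes stored for `i < s`. -/
theorem HoleStored.congr {n : ℕ} {G : SimpleGraph (Fin n)} {k i s : ℕ} {b₁ b₂ c₁ c₂ : ℕ → ℕ}
    (h : HoleStored G k i b₁ b₂) (his : i < s) (hi : i ≤ n) (hk : k ≤ n)
    (h₁ : ∀ p < s * n, c₁ p = b₁ p) (h₂ : ∀ p < s * n, c₂ p = b₂ p) :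
    HoleStored G k i c₁ c₂ := by
  obtain ⟨S, T, h, hS, hT⟩ := h
  have hs : i * n + n ≤ s * n := by
    rw [← Nat.succ_mul]; exact Nat.mul_le_mul_right n his
  refine ⟨S, T, h, ?_, ?_⟩
  · rw [hS]
    refine Finset.image_congr fun j hj => ?_
    simp only [Finset.coe_range, Set.mem_Iio] at hj
    exact (h₁ _ (by omega)).symm
  · rw [hT]
    refine Finset.image_congr fun j hj => ?_
    simp only [Finset.coe_range, Set.mem_Iio] at hj
    exact (h₂ _ (by omega)).symm

theorem RAM.holdsHoleCertificate_of_holeStored {n : ℕ} {G : SimpleGraph (Fin n)} {k : ℕ}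
    {m : RAM.Mem} (hk : m.var 1 = k) (h : ∀ i, 1 ≤ i → i ≤ k / 2 → HoleStored G k i (m.arr 1) (m.arr 2)) :
    RAM.HoldsHoleCertificate G k m := by
  choose! S T hST using h
  exact ⟨hk, S, T, fun i h₁ h₂ => (hST i h₁ h₂).1, fun i h₁ h₂ => (hST i h₁ h₂).2⟩

namespace RAM

/-! ### The subroutines -/

/-! Registers shared by the subroutines: `var 0` is `n`, `var 1` is `k`, `var 2` is `s`, array `0`
is the adjacency matrix, array `5` is the current cyclic order, row `i` of the arrays `1` and `2`,
which starts at the cell `i * n`, is the hole found for `i`, and the arrays `3` and `4` are lists of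
positions. The hypothesis `n * n + n + 2 ≤ W` of the lemmas covers every address and value. -/

/-- The adjacency matrix at the row `e` and the column `e'`. -/
def adjExp (e e' : Exp) : Exp := .get 0 (.add (.mul e (.var 0)) e')

/-- The vertex at position `e` of the current cyclic order, which is kept in array `5`. -/
def ordExp (e : Exp) : Exp := .get 5 e

/-- The order `0, …, n - 1`. -/
def initOrder : Cmd := .for 5 0 (.store 5 (.var 5) (.var 5))

/-- List in array `a` the positions of the neighbours of the vertex at position `var 18`, and count
them in `var 7`. -/
def collect (a : ℕ) : Cmd :=
  .seq (.assign 7 (.lit 0)) (.for 5 0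
    (.cond (adjExp (ordExp (.var 18)) (ordExp (.var 5)))
      (.seq (.store a (.var 7) (.var 5)) (.assign 7 (.add (.var 7) (.lit 1)))) .skip))

/-- Compute the minimum degree plus one in `var 1`. -/
def computeMinDegree : Cmd :=
  .seq (.assign 19 (.var 0)) (.seq
    (.for 18 0 (.seq (collect 3) (.cond (.lt (.var 7) (.var 19)) (.assign 19 (.var 7)) .skip)))
    (.assign 1 (.add (.var 19) (.lit 1))))

/-- Find in `var 17` a position whose vertex is not adjacent to the next one in the cyclic order;
the value `n` means that there is none. -/
def findGap : Cmd :=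
  .seq (.assign 17 (.var 0)) (.for 5 0
    (.seq (.assign 6 (.add (.var 5) (.lit 1))) (.seq
      (.cond (.eq (.var 6) (.var 0)) (.assign 6 (.lit 0)) .skip)
      (.cond (adjExp (ordExp (.var 5)) (ordExp (.var 6))) .skip (.assign 17 (.var 5))))))

/-- Reverse the segment of the order between the positions `lo` and `hi`. -/
def reverseCmd (lo hi : Exp) : Cmd :=
  .seq (.assign 15 hi) (.seq (.assign 14 lo) (.loop (.lt (.var 14) (.var 15))
    (.seq (.assign 16 (ordExp (.var 14))) (.seq (.store 5 (.var 14) (ordExp (.var 15)))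
      (.seq (.store 5 (.var 15) (.var 16)) (.seq (.assign 14 (.add (.var 14) (.lit 1)))
        (.assign 15 (.sub (.var 15) (.lit 1)))))))))

/-- Write to row `var 2` of array `dst` the vertices at the positions `p + sh - 1`, for the first
`var len` positions `p` in array `src` from the cell `var off` on. -/
def fill (dst src off sh len : ℕ) : Cmd :=
  .for 5 len (.store dst (.add (.mul (.var 2) (.var 0)) (.var 5))
    (ordExp (.sub (.add (.get src (.add (.var off) (.var 5))) (.lit sh)) (.lit 1))))

/-- Search for an edge between the first `var 2` vertices in row `var 2` of array `1` and the first
`var 9` vertices in row `var 2` of array `2`. -/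
def findEdge : Cmd :=
  .seq (.assign 11 (.lit 0)) (.for 5 2 (.for 6 9
    (.cond (adjExp (.get 1 (.add (.mul (.var 2) (.var 0)) (.var 5)))
        (.get 2 (.add (.mul (.var 2) (.var 0)) (.var 6))))
      (.seq (.assign 11 (.lit 1)) (.seq (.assign 12 (.var 5)) (.assign 13 (.var 6)))) .skip)))

/-- The variable `0` and the array `0` still hold the input. -/
structure HoldsInput {n : ℕ} (G : SimpleGraph (Fin n)) (m : Mem) : Prop where
  var : m.var 0 = n
  arr : ∀ u < n, ∀ v < n, m.arr 0 (u * n + v) ≤ 1 ∧ (m.arr 0 (u * n + v) ≠ 0 ↔ G.NatAdj u v)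

theorem holdsInput_graphInput {n : ℕ} (G : SimpleGraph (Fin n)) [DecidableRel G.Adj] :
    HoldsInput G (graphInput G) := by
  refine ⟨rfl, fun u hu v hv => ⟨?_, ?_⟩⟩
  · simp only [graphInput]
    split <;> simp
  · simp only [graphInput, true_and, ne_eq, ite_eq_right_iff, one_ne_zero, imp_false, not_not]
    constructor
    · rintro ⟨i, j, h, hij⟩
      have hn : 0 < n := by omega
      have hj : v = j := by
        have := congrArg (· % n) h
        simpa [Nat.add_mod, Nat.mod_eq_of_lt hv, Nat.mod_eq_of_lt j.2] using this
      have hi : u = i := by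
        subst hj
        exact Nat.eq_of_mul_eq_mul_right hn (Nat.add_right_cancel h)
      subst hi hj
      exact ⟨hu, hv, hij⟩
    · rintro ⟨_, _, h⟩
      exact ⟨_, _, rfl, h⟩

theorem HoldsInput.frame {n : ℕ} {G : SimpleGraph (Fin n)} {m m' : Mem} {c : Cmd}
    (h : HoldsInput G m) (hF : Frame c m m') (hv : 0 ∉ c.vars) (ha : 0 ∉ c.arrs) :
    HoldsInput G m' :=
  ⟨by rw [hF.1 0 hv, h.var], by rw [hF.2 0 ha]; exact h.arr⟩

theorem HoldsInput.setVar {n : ℕ} {G : SimpleGraph (Fin n)} {m : Mem} (h : HoldsInput G m)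
    {x : ℕ} (hx : x ≠ 0) (v : ℕ) : HoldsInput G (m.setVar x v) :=
  ⟨by simp [hx.symm, h.var], h.arr⟩

section

variable {n W : ℕ} {G : SimpleGraph (Fin n)} {m : Mem}

theorem cell_lt {u v : ℕ} (hu : u < n) (hv : v < n) : u * n + v < n * n := by
  have : (u + 1) * n ≤ n * n := Nat.mul_le_mul_right n hu
  rw [Nat.succ_mul] at this
  omega

theorem adjExp_fits (hW : n * n + n + 2 ≤ W) (hm : HoldsInput G m) {e e' : Exp} (he : e.Fits W m)
    (he' : e'.Fits W m) (hu : e.eval m < n) (hv : e'.eval m < n) : (adjExp e e').Fits W m := by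
  have := cell_lt hu hv
  have := (hm.arr _ hu _ hv).1
  simp only [adjExp, Exp.Fits, Exp.eval, hm.var]
  exact ⟨⟨⟨he, by omega, by omega⟩, he', by omega⟩, by omega⟩

theorem adjExp_eval_ne_zero (hm : HoldsInput G m) {e e' : Exp} (hu : e.eval m < n)
    (hv : e'.eval m < n) : (adjExp e e').eval m ≠ 0 ↔ G.NatAdj (e.eval m) (e'.eval m) := by
  simp only [adjExp, Exp.eval, hm.var]
  exact (hm.arr _ hu _ hv).2

theorem run_initOrder (hW : n * n + n + 2 ≤ W) (hn : 3 ≤ n) (hm : HoldsInput G m)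
    (h5 : ∀ p, m.arr 5 p = 0) :
    Run W initOrder m fun t m' => t ≤ 20 * (n * n) ∧ IsOrdering n (m'.arr 5) := by
  have hnn : 3 * n ≤ n * n := Nat.mul_le_mul_right n hn
  refine (run_for (N := n) (B := 3)
    (fun i m' => ∀ p, m'.arr 5 p = if p < i then p else 0) (by omega) hm.var (by decide)
    (by decide) (by decide) (fun i m v h => h) (by simpa using h5) ?_).mono ?_
  · intro i m' hi hx _ h
    refine run_store (by simp only [Exp.Fits]; omega) (by simp only [Exp.Fits]; omega)
      ⟨by simp [Exp.cost], fun p => ?_⟩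
    simp only [Mem.setArr_arr, Exp.eval, hx, if_true, Function.update_apply, h p]
    split <;> split <;> (try split) <;> omega
  · rintro t m' - ⟨ht, h⟩
    refine ⟨by omega, fun p => ?_, fun p hp q hq hpq => ?_⟩
    · rw [h p]; split <;> omega
    · simpa [h, hp, hq] using hpq

open Classical in
/-- The first `c` cells of `b` list in increasing order the positions below `i` of the neighbours
of `u` in the order `f`. -/
structure ListsNeighbors (G : SimpleGraph (Fin n)) (f : ℕ → ℕ) (u i : ℕ) (b : ℕ → ℕ) (c : ℕ) :
    Prop where
  count : c = ((Finset.range i).filter fun p => G.NatAdj u (f p)).card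
  lt : ∀ x < c, b x < i
  adj : ∀ x < c, G.NatAdj u (f (b x))
  mono : ∀ x y, x < y → y < c → b x < b y

theorem ListsNeighbors.succ_of_adj {f b : ℕ → ℕ} {u i c : ℕ} (h : ListsNeighbors G f u i b c)
    (hi : G.NatAdj u (f i)) :
    ListsNeighbors G f u (i + 1) (Function.update b c i) (c + 1) := by
  classical
  have key : ∀ x < c + 1, x = c ∨ x < c := by omega
  refine ⟨?_, fun x hx => ?_, fun x hx => ?_, fun x y hxy hy => ?_⟩
  · rw [Finset.range_add_one, Finset.filter_insert, if_pos hi,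
      Finset.card_insert_of_notMem (by simp), h.count]
  · rcases key x hx with rfl | hx
    · simp
    · rw [Function.update_of_ne hx.ne]
      exact (h.lt x hx).trans i.lt_succ_self
  · rcases key x hx with rfl | hx
    · simpa using hi
    · rw [Function.update_of_ne hx.ne]
      exact h.adj x hx
  · rw [Function.update_of_ne (by omega)]
    rcases key y hy with rfl | hy
    · simpa using h.lt x hxy
    · rw [Function.update_of_ne hy.ne]
      exact h.mono x y hxy hy

theorem ListsNeighbors.succ_of_not_adj {f b : ℕ → ℕ} {u i c : ℕ} (h : ListsNeighbors G f u i b c)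
    (hi : ¬ G.NatAdj u (f i)) : ListsNeighbors G f u (i + 1) b c := by
  classical
  refine ⟨?_, fun x hx => (h.lt x hx).trans i.lt_succ_self, h.adj, h.mono⟩
  rw [Finset.range_add_one, Finset.filter_insert, if_neg hi, h.count]

theorem ListsNeighbors.count_le {f b : ℕ → ℕ} {u i c : ℕ} (h : ListsNeighbors G f u i b c) :
    c ≤ i := by
  classical
  rw [h.count]
  exact (Finset.card_filter_le _ _).trans (by simp)

theorem run_collect (hW : n * n + n + 2 ≤ W) (hm : HoldsInput G m)
    (hf : IsOrdering n (m.arr 5)) (hp : m.var 18 < n) {a : ℕ} (h0 : a ≠ 0) (h5 : a ≠ 5) :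
    Run W (collect a) m fun t m' => t ≤ 40 * n + 20 ∧
      ListsNeighbors G (m.arr 5) (m.arr 5 (m.var 18)) n (m'.arr a) (m'.var 7) := by
  refine run_seq (run_assign (by simp [Exp.Fits]) ?_)
  refine (run_for (N := n) (B := 30)
    (fun i m' => ListsNeighbors G (m.arr 5) (m.arr 5 (m.var 18)) i (m'.arr a) (m'.var 7))
    (by omega) (by simp [hm.var]) (by decide)
    (by simp [Cmd.vars]) (by simp [Cmd.vars]) (fun i m v h => by simpa using h) ?_ ?_).mono ?_
  · constructor <;> simp [Exp.eval]
  · intro i m' hi hx hF h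
    have hm' : HoldsInput G m' :=
      (hm.setVar (by decide) _).frame hF (by simp [Cmd.vars, Cmd.for])
        (by simp [Cmd.arrs, Cmd.for, h0.symm])
    have e5 : m'.arr 5 = m.arr 5 := by
      rw [hF.2 5 (by simp [Cmd.arrs, Cmd.for, h5.symm])]; rfl
    have e18 : m'.var 18 = m.var 18 := by
      rw [hF.1 18 (by simp [Cmd.vars, Cmd.for])]; simp
    have hu := hf.lt (m.var 18)
    have hv := hf.lt i
    have hc := h.count_le
    have hE : G.NatAdj ((ordExp (.var 18)).eval m') ((ordExp (.var 5)).eval m') ↔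
        G.NatAdj (m.arr 5 (m.var 18)) (m.arr 5 i) := by
      simp only [ordExp, Exp.eval, e5, e18, hx]
    have hu' : (ordExp (.var 18)).eval m' < n := by simp only [ordExp, Exp.eval, e5, e18, hu]
    have hv' : (ordExp (.var 5)).eval m' < n := by simp only [ordExp, Exp.eval, e5, hx, hv]
    refine run_cond (adjExp_fits hW hm' ?_ ?_ hu' hv') ?_ ?_
    · simp only [ordExp, Exp.Fits, Exp.eval, e5, e18]; omega
    · simp only [ordExp, Exp.Fits, Exp.eval, e5, hx]; omega
    · intro ha
      rw [adjExp_eval_ne_zero hm' hu' hv', hE] at ha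
      refine run_seq (run_store (by simp only [Exp.Fits]; omega) (by simp only [Exp.Fits]; omega)
        (run_assign ?_ ⟨by simp [Exp.cost, adjExp, ordExp], ?_⟩))
      · simp only [Exp.Fits, Exp.eval, Mem.setArr_var]; omega
      · simpa [Exp.eval, hx] using h.succ_of_adj ha
    · intro ha
      have ha' : ¬ G.NatAdj (m.arr 5 (m.var 18)) (m.arr 5 i) := fun h' =>
        (adjExp_eval_ne_zero hm' hu' hv').2 (hE.2 h') ha
      exact run_skip ⟨by simp [Exp.cost, adjExp, ordExp], h.succ_of_not_adj ha'⟩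
  · rintro t m' - ⟨ht, h⟩
    exact ⟨by simp only [Exp.cost]; omega, h⟩

theorem run_computeMinDegree [DecidableRel G.Adj] (hW : n * n + n + 2 ≤ W) (hn : 3 ≤ n)
    (hm : HoldsInput G m) (hf : IsOrdering n (m.arr 5)) :
    Run W computeMinDegree m fun t m' => t ≤ 100 * (n * n) ∧ m'.var 1 = G.minDegree + 1 := by
  classical
  have hnn : 3 * n ≤ n * n := Nat.mul_le_mul_right n hn
  have hdeg (u : Fin n) := hf.card_filter_natAdj (G := G) u
  refine run_seq (run_assign (by simp only [Exp.Fits, hm.var]; omega) (run_seq ?_))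
  refine (run_for (N := n) (B := 40 * n + 40)
    (fun i m' => m'.var 19 ≤ n ∧ (∀ p < i, m'.var 19 ≤ G.degree ⟨m.arr 5 p, hf.lt p⟩) ∧
      (m'.var 19 = n ∨ ∃ u, m'.var 19 = G.degree u))
    (by omega) (by simp [hm.var]) (by decide) (by decide) (by decide)
    (fun i m v h => by simpa using h) ?_ ?_).mono ?_
  · simp [Exp.eval, hm.var]
  · rintro i m' hi hx hF ⟨h₁, h₂, h₃⟩
    have e5 : m'.arr 5 = m.arr 5 := by
      rw [hF.2 5 (by decide)]; rfl
    have hm' : HoldsInput G m' :=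
      (hm.setVar (by decide) _).frame hF (by decide) (by decide)
    refine run_seq ((run_collect hW hm' (e5 ▸ hf) (by omega) (by decide) (by decide)).mono ?_)
    rintro t₁ m₁ hF₁ ⟨ht₁, hl⟩
    have hc := hl.count
    have hcn := hl.count_le
    rw [e5, hx, hdeg ⟨m.arr 5 i, hf.lt i⟩] at hc
    have e19 : m₁.var 19 = m'.var 19 := hF₁.1 19 (by decide)
    refine run_cond (by simp only [Exp.Fits]; omega) ?_ ?_
    · intro hlt
      have hlt : m₁.var 7 < m₁.var 19 := Exp.lt_eval_ne_zero.1 hlt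
      refine run_assign (by simp only [Exp.Fits]; omega) ⟨by simp [Exp.cost]; omega, ?_, ?_, ?_⟩
      · simpa [Exp.eval] using hcn
      · intro p hp
        simp only [Exp.eval, Mem.setVar_var, if_true]
        rcases Nat.lt_succ_iff_lt_or_eq.1 hp with hp | rfl
        · exact (e19 ▸ hlt.le).trans (h₂ p hp)
        · exact hc.le
      · exact .inr ⟨_, by simpa [Exp.eval] using hc⟩
    · intro hlt
      have hlt : m₁.var 19 ≤ m₁.var 7 := Exp.lt_eval_eq_zero.1 hlt
      refine run_skip ⟨by simp [Exp.cost]; omega, by omega, ?_, by rwa [e19]⟩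
      intro p hp
      rcases Nat.lt_succ_iff_lt_or_eq.1 hp with hp | rfl
      · exact e19 ▸ h₂ p hp
      · exact hlt.trans hc.le
  · rintro t m' - ⟨ht, h₁, h₂, h₃⟩
    have hdn : ∀ u, G.degree u < n := fun u => by simpa using G.degree_lt_card_verts u
    have : Nonempty (Fin n) := ⟨⟨0, by omega⟩⟩
    have hmin : m'.var 19 = G.minDegree := by
      apply le_antisymm
      · obtain ⟨u, hu⟩ := G.exists_minimal_degree_vertex
        have hbij : Function.Bijective fun p : Fin n => (⟨m.arr 5 p, hf.lt _⟩ : Fin n) :=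
          Finite.injective_iff_bijective.1 fun p q hpq =>
            Fin.ext (hf.inj p p.2 q q.2 (Fin.mk.inj_iff.1 hpq))
        obtain ⟨p, rfl⟩ := hbij.2 u
        rw [hu]
        exact h₂ p p.2
      · rcases h₃ with h₃ | ⟨u, hu⟩
        · have := G.minDegree_le_degree ⟨0, by omega⟩
          have := hdn ⟨0, by omega⟩
          omega
        · exact hu ▸ G.minDegree_le_degree u
    refine run_assign (by simp only [Exp.Fits, Exp.eval]; omega) ⟨?_, by simp [Exp.eval, hmin]⟩
    simp only [Exp.cost]
    nlinarith

end

section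

variable {n W : ℕ} {G : SimpleGraph (Fin n)} {m : Mem}

theorem run_findGap (hW : n * n + n + 2 ≤ W) (hn : 3 ≤ n) (hm : HoldsInput G m)
    (hf : IsOrdering n (m.arr 5)) :
    Run W findGap m fun t m' => t ≤ 60 * (n * n) ∧
      ((m'.var 17 = n ∧ ∀ p < n, G.NatAdj (m.arr 5 p) (m.arr 5 ((p + 1) % n))) ∨
        (m'.var 17 < n ∧
          ¬ G.NatAdj (m.arr 5 (m'.var 17)) (m.arr 5 ((m'.var 17 + 1) % n)))) := by
  have hnn : 3 * n ≤ n * n := Nat.mul_le_mul_right n hn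
  refine run_seq (run_assign (by simp only [Exp.Fits, hm.var]; omega) ?_)
  refine (run_for (N := n) (B := 40)
    (fun i m' => (m'.var 17 = n ∧ ∀ p < i, G.NatAdj (m.arr 5 p) (m.arr 5 ((p + 1) % n))) ∨
      (m'.var 17 < n ∧ ¬ G.NatAdj (m.arr 5 (m'.var 17)) (m.arr 5 ((m'.var 17 + 1) % n))))
    (by omega) (by simp [hm.var]) (by decide) (by decide) (by decide)
    (fun i m v h => by simpa using h) (by simp [Exp.eval, hm.var]) ?_).mono ?_
  · rintro i m' hi hx hF h
    have e5 : m'.arr 5 = m.arr 5 := by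
      rw [hF.2 5 (by decide)]; rfl
    have hm' : HoldsInput G m' :=
      (hm.setVar (by decide) _).frame hF (by decide) (by decide)
    -- The rest of the round, once `var 6` holds the next position.
    have key : ∀ m₁ : Mem, HoldsInput G m₁ → m₁.arr 5 = m.arr 5 → m₁.var 5 = i →
        m₁.var 6 = (i + 1) % n → m₁.var 17 = m'.var 17 →
        Run W (.cond (adjExp (ordExp (.var 5)) (ordExp (.var 6))) .skip (.assign 17 (.var 5))) m₁
          fun t m₂ => t ≤ 20 ∧
            ((m₂.var 17 = n ∧ ∀ p < i + 1, G.NatAdj (m.arr 5 p) (m.arr 5 ((p + 1) % n))) ∨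
              (m₂.var 17 < n ∧
                ¬ G.NatAdj (m.arr 5 (m₂.var 17)) (m.arr 5 ((m₂.var 17 + 1) % n)))) := by
      intro m₁ hm₁ h5 hv5 hv6 hv17
      have hlt : (i + 1) % n < n := Nat.mod_lt _ (by omega)
      have hu := hf.lt i
      have hv := hf.lt ((i + 1) % n)
      have hu' : (ordExp (.var 5)).eval m₁ < n := by simp only [ordExp, Exp.eval, h5, hv5, hu]
      have hv' : (ordExp (.var 6)).eval m₁ < n := by simp only [ordExp, Exp.eval, h5, hv6, hv]
      have hE : (adjExp (ordExp (.var 5)) (ordExp (.var 6))).eval m₁ ≠ 0 ↔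
          G.NatAdj (m.arr 5 i) (m.arr 5 ((i + 1) % n)) := by
        rw [adjExp_eval_ne_zero hm₁ hu' hv']
        simp only [ordExp, Exp.eval, h5, hv5, hv6]
      refine run_cond (adjExp_fits hW hm₁ ?_ ?_ hu' hv') (fun ha => ?_) fun ha => ?_
      · simp only [ordExp, Exp.Fits, Exp.eval, h5, hv5]; omega
      · simp only [ordExp, Exp.Fits, Exp.eval, h5, hv6]; omega
      · refine run_skip ⟨by simp [Exp.cost, adjExp, ordExp], ?_⟩
        rw [hv17]
        refine h.imp (And.imp_right fun h p hp => ?_) id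
        rcases Nat.lt_succ_iff_lt_or_eq.1 hp with hp | rfl
        · exact h p hp
        · exact hE.1 ha
      · refine run_assign (by simp only [Exp.Fits]; omega)
          ⟨by simp [Exp.cost, adjExp, ordExp], .inr ?_⟩
        simp only [Exp.eval, Mem.setVar_var, if_true, hv5]
        exact ⟨hi, fun h' => hE.2 h' ha⟩
    refine run_seq (run_assign (by simp only [Exp.Fits, Exp.eval]; omega) (run_seq ?_))
    have hm₁ := hm'.setVar (x := 6) (by decide) ((Exp.add (.var 5) (.lit 1)).eval m')
    refine run_cond ?_ (fun he => ?_) fun he => ?_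
    · simp [Exp.Fits, Exp.eval, hm'.var]; omega
    · rw [Exp.eq_eval_ne_zero] at he
      refine run_assign (by simp [Exp.Fits]) ((key _ (hm₁.setVar (by decide) _) e5
        (by simpa using hx) ?_ (by simp)).mono ?_)
      · have : i + 1 = n := by simpa [Exp.eval, hx, hm'.var] using he
        simp [Exp.eval, this]
      · rintro t₂ m₂ - ⟨ht₂, h₂⟩
        exact ⟨by simp only [Exp.cost]; omega, h₂⟩
    · rw [Exp.eq_eval_eq_zero] at he
      refine run_skip ((key _ hm₁ e5 (by simpa using hx) ?_ (by simp)).mono ?_)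
      · have : i + 1 ≠ n := by simpa [Exp.eval, hx, hm'.var] using he
        simp [Exp.eval, hx, Nat.mod_eq_of_lt (show i + 1 < n by omega)]
      · rintro t₂ m₂ - ⟨ht₂, h₂⟩
        exact ⟨by simp only [Exp.cost]; omega, h₂⟩
  · rintro t m' - ⟨ht, h⟩
    exact ⟨by simp only [Exp.cost]; omega, h⟩

theorem run_reverseCmd (hW : n * n + n + 2 ≤ W) (hn : 3 ≤ n) (hf : IsOrdering n (m.arr 5))
    {lo hi : Exp} {l h : ℕ} (hhi : hi.Fits W m) (hh : hi.eval m = h) (hhn : h < n) (hln : l ≤ n)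
    (hlo : ∀ v, lo.Fits W (m.setVar 15 v) ∧ lo.eval (m.setVar 15 v) = l)
    (hc : lo.cost + hi.cost ≤ 20) :
    Run W (reverseCmd lo hi) m fun t m' => t ≤ 60 * (n * n) ∧
      m'.arr 5 = reverseSeg (m.arr 5) l h ∧ IsOrdering n (m'.arr 5) := by
  have hnn : 3 * n ≤ n * n := Nat.mul_le_mul_right n hn
  refine run_seq (run_assign hhi (run_seq (run_assign (hlo _).1 ?_)))
  refine (run_loop (B := 18) (fun v m' => m'.var 15 - m'.var 14 ≤ v ∧ m'.var 15 < n ∧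
    m'.var 14 ≤ n ∧ (∀ p, m'.arr 5 p < n) ∧
    reverseSeg (m'.arr 5) (m'.var 14) (m'.var 15) = reverseSeg (m.arr 5) l h) ?_ n _ ?_).mono ?_
  · rintro v m' ⟨h₁, h₂, h₃, h₄, h₅⟩
    have h₆ := h₄ (m'.var 14)
    have h₇ := h₄ (m'.var 15)
    refine ⟨by simp only [Exp.Fits]; omega, fun he => ?_⟩
    rw [Exp.lt_eval_ne_zero] at he
    simp only [Exp.eval] at he
    refine run_seq (run_assign ?_ (run_seq (run_store ?_ ?_ (run_seq (run_store ?_ ?_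
      (run_seq (run_assign ?_ (run_assign ?_ ⟨?_, v - 1, by omega, ?_⟩))))))))
    · simp only [ordExp, Exp.Fits, Exp.eval]; omega
    · simp [Exp.Fits]; omega
    · simp [ordExp, Exp.Fits, Exp.eval]; omega
    · simp [Exp.Fits]; omega
    · simp [ordExp, Exp.Fits, Exp.eval]; omega
    · simp [Exp.Fits, Exp.eval]; omega
    · simp [Exp.Fits]; omega
    · simp [Exp.cost, ordExp]
    · simp only [ordExp, Exp.eval, Mem.setVar_var, Mem.setArr_arr, Mem.setArr_var, Mem.setVar_arr]
      simp only [if_true, if_false, Nat.reduceEqDiff]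
      refine ⟨by omega, by omega, by omega, fun p => ?_, ?_⟩
      · simp only [Function.update_apply]
        split
        · exact h₆
        · split
          · exact h₇
          · exact h₄ p
      · rw [reverseSeg_swap _ he, h₅]
  · subst hh
    simp [(hlo _).2, hf.lt]
    omega
  · rintro t m' - ⟨ht, he, v, h₁, h₂, h₃, h₄, h₅⟩
    have he' : m'.var 15 ≤ m'.var 14 := Exp.lt_eval_eq_zero.1 he
    rw [reverseSeg_of_le _ he'] at h₅
    refine ⟨?_, h₅, h₅ ▸ hf.reverseSeg hhn⟩
    simp only [Exp.cost] at ht ⊢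
    omega

theorem run_fill (hW : n * n + n + 2 ≤ W) (hn : 3 ≤ n) (hm : HoldsInput G m)
    (hf : IsOrdering n (m.arr 5)) {dst src off sh len : ℕ} (hd5 : dst ≠ 5)
    (hds : dst ≠ src) (hoff : off ≠ 5) (hlen : len ≠ 5) (hsh : sh ≤ 2) (hs : m.var 2 ≤ n)
    (hl : m.var len ≤ n) (ho : m.var off ≤ n)
    (hb : ∀ x < m.var len, m.arr src (m.var off + x) ≤ n) :
    Run W (fill dst src off sh len) m fun t m' => t ≤ 30 * (n * n) ∧
      (∀ x < m.var len, m'.arr dst (m.var 2 * n + x) =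
        m.arr 5 (m.arr src (m.var off + x) + sh - 1)) ∧
      ∀ p < m.var 2 * n, m'.arr dst p = m.arr dst p := by
  have hnn : 3 * n ≤ n * n := Nat.mul_le_mul_right n hn
  have hsn : m.var 2 * n ≤ n * n := Nat.mul_le_mul_right n hs
  refine (run_for (N := m.var len) (B := 20)
    (fun i m' => (∀ x < i, m'.arr dst (m.var 2 * n + x) =
        m.arr 5 (m.arr src (m.var off + x) + sh - 1)) ∧
      ∀ p < m.var 2 * n, m'.arr dst p = m.arr dst p)
    (by omega) rfl hlen (by simp [Cmd.vars]) (by simp [Cmd.vars])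
    (fun i m v h => by simpa using h) (by simp) ?_).mono ?_
  · rintro i m' hi hx hF ⟨h₁, h₂⟩
    have e5 : m'.arr 5 = m.arr 5 := hF.2 5 (by simp [Cmd.arrs, Cmd.for, hd5.symm])
    have es : m'.arr src = m.arr src := hF.2 src (by simp [Cmd.arrs, Cmd.for, hds.symm])
    have e0 : m'.var 0 = n := by rw [hF.1 0 (by simp [Cmd.vars, Cmd.for]), hm.var]
    have e2 : m'.var 2 = m.var 2 := hF.1 2 (by simp [Cmd.vars, Cmd.for])
    have eo : m'.var off = m.var off := hF.1 off (by simp [Cmd.vars, Cmd.for, hoff])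
    have hbi := hb i hi
    have hfi := hf.lt (m.arr src (m.var off + i) + sh - 1)
    refine run_store ?_ ?_ ⟨by simp [Exp.cost, ordExp], fun x hx' => ?_, fun p hp => ?_⟩
    · simp only [Exp.Fits, Exp.eval, hx, e0, e2]; omega
    · simp only [ordExp, Exp.Fits, Exp.eval, hx, e5, es, eo]; omega
    · simp only [ordExp, Exp.eval, hx, e0, e2, e5, es, eo, Mem.setArr_arr, if_true]
      rcases Nat.lt_succ_iff_lt_or_eq.1 hx' with hx' | rfl
      · rw [Function.update_of_ne (by omega), h₁ x hx']
      · rw [Function.update_self]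
    · simp only [Exp.eval, hx, e0, e2, Mem.setArr_arr, if_true]
      rw [Function.update_of_ne (by omega), h₂ p hp]
  · rintro t m' - ⟨ht, h⟩
    exact ⟨by nlinarith, h⟩

theorem run_findEdge (hW : n * n + n + 2 ≤ W) (hn : 3 ≤ n) (hm : HoldsInput G m) {s r : ℕ}
    (h2 : m.var 2 = s) (h9 : m.var 9 = r) (hs : s ≤ n) (hr : r ≤ n)
    (hlt₁ : ∀ x < s, m.arr 1 (s * n + x) < n) (hlt₂ : ∀ y < r, m.arr 2 (s * n + y) < n) :
    Run W findEdge m fun t m' => t ≤ 100 * (n * n) ∧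
      ((m'.var 11 = 0 ∧
          ∀ x < s, ∀ y < r, ¬ G.NatAdj (m.arr 1 (s * n + x)) (m.arr 2 (s * n + y))) ∨
        (m'.var 11 = 1 ∧ m'.var 12 < s ∧ m'.var 13 < r ∧
          G.NatAdj (m.arr 1 (s * n + m'.var 12)) (m.arr 2 (s * n + m'.var 13)))) := by
  have hnn : 3 * n ≤ n * n := Nat.mul_le_mul_right n hn
  have hsn : s * n ≤ n * n := Nat.mul_le_mul_right n hs
  have hsr : s * r ≤ n * n := Nat.mul_le_mul hs hr
  refine run_seq (run_assign (by simp [Exp.Fits]) ?_)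
  refine (run_for (N := s) (B := r * 48 + 8)
    (fun i m' => (m'.var 11 = 0 ∧
          ∀ x < i, ∀ y < r, ¬ G.NatAdj (m.arr 1 (s * n + x)) (m.arr 2 (s * n + y))) ∨
        (m'.var 11 = 1 ∧ m'.var 12 < s ∧ m'.var 13 < r ∧
          G.NatAdj (m.arr 1 (s * n + m'.var 12)) (m.arr 2 (s * n + m'.var 13))))
    (by omega) (by simp [h2]) (by decide) (by decide) (by decide)
    (fun i m v h => by simpa using h) (by simp [Exp.eval]) ?_).mono ?_
  · intro i m' hi hx hF h
    refine (run_for (N := r) (B := 40)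
      (fun j m₁ => (m₁.var 11 = 0 ∧
            (∀ x < i, ∀ y < r, ¬ G.NatAdj (m.arr 1 (s * n + x)) (m.arr 2 (s * n + y))) ∧
            ∀ y < j, ¬ G.NatAdj (m.arr 1 (s * n + i)) (m.arr 2 (s * n + y))) ∨
          (m₁.var 11 = 1 ∧ m₁.var 12 < s ∧ m₁.var 13 < r ∧
            G.NatAdj (m.arr 1 (s * n + m₁.var 12)) (m.arr 2 (s * n + m₁.var 13))))
      (by omega) ?_ (by decide) (by decide) (by decide)
      (fun i m v h => by simpa using h) (by simpa using h) ?_).mono ?_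
    · rw [hF.1 9 (by decide)]; simp [h9]
    · intro j m₁ hj hx₁ hF₁ h'
      have hm₁ : HoldsInput G m₁ :=
        ((hm.setVar (by decide) _).frame hF (by decide) (by decide)).frame hF₁
          (by decide) (by decide)
      have e1 : m₁.arr 1 = m.arr 1 := by rw [hF₁.2 1 (by decide), hF.2 1 (by decide)]; rfl
      have e2 : m₁.arr 2 = m.arr 2 := by rw [hF₁.2 2 (by decide), hF.2 2 (by decide)]; rfl
      have v2 : m₁.var 2 = s := by rw [hF₁.1 2 (by decide), hF.1 2 (by decide)]; simp [h2]
      have v5 : m₁.var 5 = i := by rw [hF₁.1 5 (by decide), hx]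
      have v0 := hm₁.var
      have hu := hlt₁ i hi
      have hv := hlt₂ j hj
      set e : Exp := .get 1 (.add (.mul (.var 2) (.var 0)) (.var 5)) with he
      set e' : Exp := .get 2 (.add (.mul (.var 2) (.var 0)) (.var 6)) with he'
      have ee : e.eval m₁ = m.arr 1 (s * n + i) := by simp only [he, Exp.eval, e1, v2, v0, v5]
      have ee' : e'.eval m₁ = m.arr 2 (s * n + j) := by simp only [he', Exp.eval, e2, v2, v0, hx₁]
      have hE : (adjExp e e').eval m₁ ≠ 0 ↔
          G.NatAdj (m.arr 1 (s * n + i)) (m.arr 2 (s * n + j)) := by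
        rw [adjExp_eval_ne_zero hm₁ (ee ▸ hu) (ee' ▸ hv), ee, ee']
      refine run_cond (adjExp_fits hW hm₁ ?_ ?_ (ee ▸ hu) (ee' ▸ hv)) (fun ha => ?_) fun ha => ?_
      · simp only [he, Exp.Fits, Exp.eval, e1, v2, v0, v5]; omega
      · simp only [he', Exp.Fits, Exp.eval, e2, v2, v0, hx₁]; omega
      · refine run_seq (run_assign (by simp only [Exp.Fits]; omega) (run_seq
          (run_assign ?_ (run_assign ?_ ⟨?_, .inr ?_⟩))))
        · simp [Exp.Fits, v5]; omega
        · simp [Exp.Fits, hx₁]; omega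
        · simp [Exp.cost, adjExp, he, he']
        · simpa [Exp.eval, v5, hx₁] using ⟨hi, hj, hE.1 ha⟩
      · refine run_skip ⟨by simp [Exp.cost, adjExp, he, he'], ?_⟩
        refine h'.imp (And.imp_right (And.imp_right fun h y hy => ?_)) id
        rcases Nat.lt_succ_iff_lt_or_eq.1 hy with hy | rfl
        · exact h y hy
        · exact fun h' => hE.2 h' ha
    · rintro t m₁ - ⟨ht, h'⟩
      refine ⟨ht, h'.imp (And.imp_right fun h x hx' => ?_) id⟩
      rcases Nat.lt_succ_iff_lt_or_eq.1 hx' with hx' | rfl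
      · exact h.1 x hx'
      · exact h.2
  · rintro t m' - ⟨ht, h⟩
    exact ⟨by simp only [Exp.cost]; nlinarith, h⟩

end

/-! ### One round of the algorithm -/

/-- Reverse the cyclic order and start it so that the gap found in `var 17` is between its last and
its first vertex. -/
def rotateGap : Cmd :=
  .seq (reverseCmd (.lit 0) (.var 17))
    (reverseCmd (.add (.var 17) (.lit 1)) (.sub (.var 0) (.lit 1)))

/-- Move the gap to the end, list the positions of the neighbours of the first vertex in array `3`
and those of the last vertex in array `4`, set `var 9` to `k - s`, and `var 10` to the index
in array `4` from which on there are `k - s` entries. -/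
def prepare : Cmd :=
  .seq rotateGap (.seq (.assign 18 (.lit 0)) (.seq (collect 3)
    (.seq (.assign 18 (.sub (.var 0) (.lit 1))) (.seq (collect 4)
      (.seq (.assign 9 (.sub (.var 1) (.var 2))) (.assign 10 (.sub (.var 7) (.var 9))))))))

/-- Write the candidate for an `(s, k - s)`-bipartite-hole and search for an edge in it. -/
def searchHole (src₁ src₂ sh : ℕ) : Cmd :=
  .seq (.assign 8 (.lit 0)) (.seq (fill 1 src₁ 8 0 2) (.seq (fill 2 src₂ 10 sh 9) findEdge))

/-- The exchange along an edge between a predecessor of an early neighbour of the first vertex and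
a successor of a late neighbour of the last vertex. -/
def exchangeLe : Cmd :=
  .seq (reverseCmd (.lit 0) (.sub (.get 3 (.var 12)) (.lit 1)))
    (reverseCmd (.add (.get 4 (.add (.var 10) (.var 13))) (.lit 1)) (.sub (.var 0) (.lit 1)))

/-- The exchange along an edge between a predecessor of an early neighbour of the last vertex and
a predecessor of a late neighbour of the first vertex. -/
def exchangeLt : Cmd :=
  .seq (reverseCmd (.get 4 (.var 12)) (.sub (.get 3 (.add (.var 10) (.var 13))) (.lit 1)))
    (reverseCmd (.get 3 (.add (.var 10) (.var 13))) (.sub (.var 0) (.lit 1)))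

/-- Find a bipartite hole or improve the order, if sufficiently many neighbours of the last vertex
come after the first `s` neighbours of the first vertex. -/
def stepLe : Cmd :=
  .seq (searchHole 3 4 2) (.cond (.var 11) exchangeLe (.assign 2 (.add (.var 2) (.lit 1))))

/-- Find a bipartite hole or improve the order in the opposite case. -/
def stepLt : Cmd :=
  .seq (.assign 10 (.sub (.var 2) (.lit 1)))
    (.seq (searchHole 4 3 0) (.cond (.var 11) exchangeLt (.assign 2 (.add (.var 2) (.lit 1)))))

/-- Close the gap found in `var 17` or find a bipartite hole. -/
def step : Cmd :=
  .seq prepare (.cond (.lt (.get 4 (.var 10)) (.get 3 (.sub (.var 2) (.lit 1)))) stepLt stepLe)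

/-- The invariant of the algorithm: the `(i, k - i)`-bipartite-holes for `i < s` have been found,
where `s` is the value of `var 2`. -/
structure Inv {n : ℕ} (G : SimpleGraph (Fin n)) (k : ℕ) (m : Mem) : Prop where
  input : HoldsInput G m
  order : IsOrdering n (m.arr 5)
  k_eq : m.var 1 = k
  s_pos : 1 ≤ m.var 2
  s_le : m.var 2 ≤ k / 2 + 1
  holes : ∀ i, 1 ≤ i → i < m.var 2 → HoleStored G k i (m.arr 1) (m.arr 2)

/-- The quantity that decreases in each round: the number of gaps plus the number of holes that
are still to be found, up to a constant. -/
noncomputable def potential {n : ℕ} (G : SimpleGraph (Fin n)) (k : ℕ) (m : Mem) : ℕ :=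
  cycleGaps G.NatAdj n (m.arr 5) + (k + 2 - m.var 2)

/-- The invariant after `prepare`. -/
structure Prepared {n : ℕ} (G : SimpleGraph (Fin n)) (k : ℕ) (m : Mem) : Prop
    extends Inv G k m where
  gap : ¬ G.NatAdj (m.arr 5 (n - 1)) (m.arr 5 0)
  s_le_half : 2 * m.var 2 ≤ k
  var_nine : m.var 9 = k - m.var 2
  lists_first : ∃ c, k ≤ c + 1 ∧ ListsNeighbors G (m.arr 5) (m.arr 5 0) n (m.arr 3) c
  lists_last : k ≤ m.var 10 + m.var 9 + 1 ∧
    ListsNeighbors G (m.arr 5) (m.arr 5 (n - 1)) n (m.arr 4) (m.var 10 + m.var 9)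

section

variable {n W k : ℕ} {G : SimpleGraph (Fin n)} {m : Mem}

theorem ListsNeighbors.mono_le {f b : ℕ → ℕ} {u i c x y : ℕ} (h : ListsNeighbors G f u i b c)
    (hxy : x ≤ y) (hy : y < c) : b x ≤ b y := by
  rcases hxy.lt_or_eq with h' | rfl
  · exact (h.mono x y h' hy).le
  · exact le_rfl

theorem ListsNeighbors.inj {f b : ℕ → ℕ} {u i c x y : ℕ} (h : ListsNeighbors G f u i b c)
    (hx : x < c) (hy : y < c) (hxy : b x = b y) : x = y := by
  rcases lt_trichotomy x y with h' | h' | h'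
  · exact absurd hxy (h.mono x y h' hy).ne
  · exact h'
  · exact absurd hxy (h.mono y x h' hx).ne'

/-- The neighbours of the ends of a cyclic order with a gap between its ends are inside. -/
theorem ListsNeighbors.pos_lt {f b : ℕ → ℕ} {u c : ℕ} (h : ListsNeighbors G f u n b c)
    (hgap : ¬ G.NatAdj (f (n - 1)) (f 0)) (hu : u = f 0 ∨ u = f (n - 1)) {x : ℕ} (hx : x < c) :
    0 < b x ∧ b x < n - 1 := by
  have h₁ := h.adj x hx
  have h₂ := h.lt x hx
  constructor
  · refine Nat.pos_of_ne_zero fun h0 => ?_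
    rw [h0] at h₁
    rcases hu with rfl | rfl
    · exact SimpleGraph.not_natAdj_self h₁
    · exact hgap h₁
  · refine lt_of_le_of_ne (by omega) fun h0 => ?_
    rw [h0] at h₁
    rcases hu with rfl | rfl
    · exact hgap h₁.symm
    · exact SimpleGraph.not_natAdj_self h₁

theorem run_prepare [DecidableRel G.Adj] (hW : n * n + n + 2 ≤ W) (hn : 3 ≤ n)
    (hm : Inv G (G.minDegree + 1) m) (hs : 2 * m.var 2 ≤ G.minDegree + 1) (h17 : m.var 17 < n)
    (hgap : ¬ G.NatAdj (m.arr 5 (m.var 17)) (m.arr 5 ((m.var 17 + 1) % n))) :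
    Run W prepare m fun t m' => t ≤ 200 * (n * n) ∧ Prepared G (G.minDegree + 1) m' ∧
      potential G (G.minDegree + 1) m' = potential G (G.minDegree + 1) m := by
  classical
  have hnn : 3 * n ≤ n * n := Nat.mul_le_mul_right n hn
  have hk : G.minDegree < n := by
    have : Nonempty (Fin n) := ⟨⟨0, by omega⟩⟩
    simpa using G.minDegree_lt_card
  have hpos := hm.s_pos
  refine run_seq (run_seq ((run_reverseCmd hW hn hm.order (l := 0) (h := m.var 17)
    (by simp only [Exp.Fits]; omega) rfl h17 (by omega) (by simp [Exp.Fits, Exp.eval])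
    (by simp [Exp.cost])).mono ?_))
  rintro t₁ m₁ hF₁ ⟨ht₁, he₁, ho₁⟩
  have hin₁ : HoldsInput G m₁ := hm.input.frame hF₁ (by decide) (by decide)
  have v17 : m₁.var 17 = m.var 17 := hF₁.1 17 (by decide)
  refine (run_reverseCmd hW hn ho₁ (l := m.var 17 + 1) (h := n - 1)
    (by simp only [Exp.Fits, hin₁.var]; omega) (by simp [Exp.eval, hin₁.var]) (by omega) (by omega)
    (fun v => ?_) (by simp [Exp.cost])).mono ?_
  · simp [Exp.Fits, Exp.eval, v17]; omega
  rintro t₂ m₂ hF₂ ⟨ht₂, he₂, ho₂⟩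
  rw [he₁] at he₂
  have hin₂ : HoldsInput G m₂ := hin₁.frame hF₂ (by decide) (by decide)
  have hrot : cycleGaps G.NatAdj n (m₂.arr 5) = cycleGaps G.NatAdj n (m.arr 5) := by
    rw [he₂, cycleGaps_rotate (fun _ _ => SimpleGraph.NatAdj.symm) _ h17]
  have hgap₂ : ¬ G.NatAdj (m₂.arr 5 (n - 1)) (m₂.arr 5 0) := by
    have e0 : m₂.arr 5 0 = m.arr 5 (m.var 17) := by
      rw [he₂, reverseSeg_of_lt (by omega), reverseSeg_of_mem le_rfl (by omega)]
      congr 1; omega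
    have e1 : m₂.arr 5 (n - 1) = m.arr 5 ((m.var 17 + 1) % n) := by
      rcases Nat.lt_or_ge (m.var 17 + 1) n with h | h
      · rw [he₂, reverseSeg_of_mem (by omega) le_rfl, reverseSeg_of_gt (by omega),
          Nat.mod_eq_of_lt h]
        congr 1; omega
      · rw [he₂, reverseSeg_of_lt (by omega), reverseSeg_of_mem (by omega) (by omega),
          show m.var 17 + 1 = n by omega, Nat.mod_self]
        congr 1; omega
    rw [e0, e1]
    exact fun h => hgap h.symm
  refine run_seq (run_assign (by simp [Exp.Fits]) (run_seq ((run_collect hW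
    (hin₂.setVar (by decide) _) ho₂ ?_ (by decide) (by decide)).mono ?_)))
  · simp [Exp.eval]; omega
  rintro t₃ m₃ hF₃ ⟨ht₃, hl₃⟩
  have a5₃ : m₃.arr 5 = m₂.arr 5 := hF₃.2 5 (by decide)
  have hin₃ : HoldsInput G m₃ := (hin₂.setVar (by decide) _).frame hF₃ (by decide) (by decide)
  refine run_seq (run_assign (by simp only [Exp.Fits, hin₃.var]; omega) (run_seq ((run_collect hW
    (hin₃.setVar (by decide) _) (a5₃ ▸ ho₂ :) ?_ (by decide) (by decide)).mono ?_)))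
  · simp [Exp.eval, hin₃.var]; omega
  rintro t₄ m₄ hF₄ ⟨ht₄, hl₄⟩
  have a5₄ : m₄.arr 5 = m₂.arr 5 := (hF₄.2 5 (by decide)).trans a5₃
  have a3₄ : m₄.arr 3 = m₃.arr 3 := hF₄.2 3 (by decide)
  have hin₄ : HoldsInput G m₄ := (hin₃.setVar (by decide) _).frame hF₄ (by decide) (by decide)
  have v1 : m₄.var 1 = G.minDegree + 1 := by
    rw [hF₄.1 1 (by decide), ← hm.k_eq]
    simp only [Mem.setVar_var, Nat.reduceEqDiff, if_false]
    rw [hF₃.1 1 (by decide)]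
    simp only [Mem.setVar_var, Nat.reduceEqDiff, if_false]
    rw [hF₂.1 1 (by decide), hF₁.1 1 (by decide)]
  have v2 : m₄.var 2 = m.var 2 := by
    rw [hF₄.1 2 (by decide)]
    simp only [Mem.setVar_var, Nat.reduceEqDiff, if_false]
    rw [hF₃.1 2 (by decide)]
    simp only [Mem.setVar_var, Nat.reduceEqDiff, if_false]
    rw [hF₂.1 2 (by decide), hF₁.1 2 (by decide)]
  have a1 : m₄.arr 1 = m.arr 1 := by
    rw [hF₄.2 1 (by decide), Mem.setVar_arr, hF₃.2 1 (by decide), Mem.setVar_arr,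
      hF₂.2 1 (by decide), hF₁.2 1 (by decide)]
  have a2 : m₄.arr 2 = m.arr 2 := by
    rw [hF₄.2 2 (by decide), Mem.setVar_arr, hF₃.2 2 (by decide), Mem.setVar_arr,
      hF₂.2 2 (by decide), hF₁.2 2 (by decide)]
  have hl₃' : ListsNeighbors G (m₂.arr 5) (m₂.arr 5 0) n (m₃.arr 3) (m₃.var 7) := by
    simpa [Exp.eval] using hl₃
  have hl₄' : ListsNeighbors G (m₂.arr 5) (m₂.arr 5 (n - 1)) n (m₄.arr 4) (m₄.var 7) := by
    simpa [Exp.eval, hin₃.var, a5₃] using hl₄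
  have hdeg : ∀ p b c, ListsNeighbors G (m₂.arr 5) (m₂.arr 5 p) n b c → G.minDegree ≤ c := by
    intro p b c hl
    rw [hl.count]
    exact (G.minDegree_le_degree ⟨_, ho₂.lt p⟩).trans
      (ho₂.card_filter_natAdj (G := G) ⟨_, ho₂.lt p⟩).ge
  have hc₃ := hdeg _ _ _ hl₃'
  have hc₄ := hdeg _ _ _ hl₄'
  have hc₄n := hl₄'.count_le
  refine run_seq (run_assign (by simp only [Exp.Fits]; omega) (run_assign ?_ ⟨?_, ⟨⟨?_, ?_, ?_, ?_,
    ?_, ?_⟩, ?_, ?_, ?_, ?_, ?_⟩, ?_⟩))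
  · simp [Exp.Fits, Exp.eval]; omega
  · simp only [Exp.cost]; omega
  · exact (hin₄.setVar (by decide) _).setVar (by decide) _
  · simpa [a5₄] using ho₂
  · simp [v1]
  · simpa [v2] using hpos
  · simpa [v2] using hm.s_le
  · simpa [v2, a1, a2] using hm.holes
  · simpa [a5₄] using hgap₂
  · simpa [v2] using hs
  · simp [Exp.eval, v1, v2]
  · exact ⟨_, Nat.succ_le_succ hc₃, by simpa [a5₄, a3₄] using hl₃'⟩
  · have e : m₄.var 7 - (G.minDegree + 1 - m.var 2) + (G.minDegree + 1 - m.var 2) = m₄.var 7 := by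
      omega
    simp [Exp.eval, v1, v2, a5₄, e, hl₄', hc₄]
  · simp [potential, a5₄, v2, hrot]

theorem run_searchHole (hW : n * n + n + 2 ≤ W) (hn : 3 ≤ n) (hm : Inv G k m)
    (hk : k ≤ n) (hs : 2 * m.var 2 ≤ k) (h9 : m.var 9 = k - m.var 2) {src₁ src₂ sh : ℕ}
    (hsrc₁ : 2 < src₁) (hsrc₂ : 2 < src₂) (hsh : sh ≤ 2) (h10 : m.var 10 ≤ n)
    (hb₁ : ∀ x < m.var 2, 0 < m.arr src₁ x ∧ m.arr src₁ x < n - 1)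
    (hinj₁ : ∀ x < m.var 2, ∀ y < m.var 2, m.arr src₁ x = m.arr src₁ y → x = y)
    (hb₂ : ∀ y < m.var 9, 0 < m.arr src₂ (m.var 10 + y) ∧ m.arr src₂ (m.var 10 + y) < n - 1)
    (hinj₂ : ∀ x < m.var 9, ∀ y < m.var 9,
      m.arr src₂ (m.var 10 + x) = m.arr src₂ (m.var 10 + y) → x = y)
    (hne : ∀ x < m.var 2, ∀ y < m.var 9,
      m.arr src₁ x - 1 ≠ m.arr src₂ (m.var 10 + y) + sh - 1) :
    Run W (searchHole src₁ src₂ sh) m fun t m' => t ≤ 200 * (n * n) ∧ Inv G k m' ∧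
      ((m'.var 11 = 0 ∧ HoleStored G k (m.var 2) (m'.arr 1) (m'.arr 2)) ∨
        (m'.var 11 = 1 ∧ m'.var 12 < m.var 2 ∧ m'.var 13 < m.var 9 ∧
          G.NatAdj (m.arr 5 (m.arr src₁ (m'.var 12) - 1))
            (m.arr 5 (m.arr src₂ (m.var 10 + m'.var 13) + sh - 1)))) := by
  have hnn : 3 * n ≤ n * n := Nat.mul_le_mul_right n hn
  have hpos := hm.s_pos
  refine run_seq (run_assign (by simp [Exp.Fits]) (run_seq ?_))
  refine (run_fill hW hn (hm.input.setVar (by decide) _) hm.order (by decide)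
    (by omega) (by decide) (by decide) (by decide) ?_ ?_ ?_ ?_).mono ?_
  · simp; omega
  · simp; omega
  · simp [Exp.eval]
  · intro x hx
    have := hb₁ x (by simpa using hx)
    simp [Exp.eval]; omega
  rintro t₁ m₁ hF₁ ⟨ht₁, hc₁, hp₁⟩
  simp only [Mem.setVar_var, Mem.setVar_arr, Nat.reduceEqDiff, if_false, if_true, Exp.eval,
    Nat.zero_add, Nat.add_zero] at hc₁ hp₁
  have hin₁ : HoldsInput G m₁ :=
    (hm.input.setVar (by decide) _).frame hF₁ (by simp [fill, Cmd.vars, Cmd.for])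
      (by simp [fill, Cmd.arrs, Cmd.for])
  have v₁ : ∀ x, x ≠ 8 → x ≠ 5 → m₁.var x = m.var x := fun x h h' => by
    rw [hF₁.1 x (by simp [fill, Cmd.vars, Cmd.for, h'])]; simp [h]
  have a₁ : ∀ a, a ≠ 1 → m₁.arr a = m.arr a := fun a h => by
    rw [hF₁.2 a (by simp [fill, Cmd.arrs, Cmd.for, h])]; simp
  refine run_seq ((run_fill hW hn hin₁ (by rw [a₁ 5 (by decide)]; exact hm.order) (by decide)
    (by omega) (by decide) (by decide) hsh ?_ ?_ ?_ ?_).mono ?_)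
  · rw [v₁ 2 (by decide) (by decide)]; omega
  · rw [v₁ 9 (by decide) (by decide)]; omega
  · rw [v₁ 10 (by decide) (by decide)]; omega
  · rw [v₁ 9 (by decide) (by decide), v₁ 10 (by decide) (by decide), a₁ src₂ (by omega)]
    intro x hx
    have := hb₂ x hx
    omega
  rintro t₂ m₂ hF₂ ⟨ht₂, hc₂, hp₂⟩
  have hin₂ : HoldsInput G m₂ :=
    hin₁.frame hF₂ (by simp [fill, Cmd.vars, Cmd.for]) (by simp [fill, Cmd.arrs, Cmd.for])
  have v₂ : ∀ x, x ≠ 8 → x ≠ 5 → m₂.var x = m.var x := fun x h h' => by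
    rw [hF₂.1 x (by simp [fill, Cmd.vars, Cmd.for, h']), v₁ x h h']
  have a₂ : ∀ a, a ≠ 1 → a ≠ 2 → m₂.arr a = m.arr a := fun a h h' => by
    rw [hF₂.2 a (by simp [fill, Cmd.arrs, Cmd.for, h']), a₁ a h]
  have a₂1 : m₂.arr 1 = m₁.arr 1 := hF₂.2 1 (by simp [fill, Cmd.arrs, Cmd.for])
  rw [v₁ 2 (by decide) (by decide), v₁ 9 (by decide) (by decide), v₁ 10 (by decide) (by decide),
    a₁ 5 (by decide), a₁ src₂ (by omega)] at hc₂
  rw [v₁ 2 (by decide) (by decide), a₁ 2 (by decide)] at hp₂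
  rw [← a₂1] at hc₁ hp₁
  refine (run_findEdge hW hn hin₂ (v₂ 2 (by decide) (by decide)) (v₂ 9 (by decide) (by decide))
    (by omega) (by omega) ?_ ?_).mono ?_
  · intro x hx
    rw [hc₁ x hx]; exact hm.order.lt _
  · intro y hy
    rw [hc₂ y hy]; exact hm.order.lt _
  rintro t₃ m₃ hF₃ ⟨ht₃, h₃⟩
  have a₃ : ∀ a, m₃.arr a = m₂.arr a := fun a => hF₃.2 a (by simp [findEdge, Cmd.arrs, Cmd.for])
  have v₃1 : m₃.var 1 = m.var 1 :=
    (hF₃.1 1 (by decide)).trans (v₂ 1 (by decide) (by decide))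
  have v₃2 : m₃.var 2 = m.var 2 :=
    (hF₃.1 2 (by decide)).trans (v₂ 2 (by decide) (by decide))
  refine ⟨by simp only [Exp.cost]; omega, ⟨hin₂.frame hF₃ (by decide) (by decide), ?_, ?_, ?_, ?_,
    ?_⟩, ?_⟩
  · rw [a₃, a₂ 5 (by decide) (by decide)]; exact hm.order
  · rw [v₃1, hm.k_eq]
  · rw [v₃2]; exact hpos
  · rw [v₃2]; exact hm.s_le
  · rw [v₃2, a₃, a₃]
    exact fun i hi his => (hm.holes i hi his).congr his (by omega) hk hp₁ hp₂
  · rcases h₃ with ⟨h11, hno⟩ | ⟨h11, h12, h13, hadj⟩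
    · refine .inl ⟨h11, ?_⟩
      rw [a₃, a₃]
      apply holeStored_of_not_natAdj
      · intro x hx
        rw [hc₁ x hx]; exact hm.order.lt _
      · intro x hx y hy hxy
        rw [hc₁ x hx, hc₁ y hy] at hxy
        have := hb₁ x hx
        have := hb₁ y hy
        have := hm.order.inj _ (by omega) _ (by omega) hxy
        exact hinj₁ x hx y hy (by omega)
      · intro y hy
        rw [hc₂ y (h9 ▸ hy)]; exact hm.order.lt _
      · intro x hx y hy hxy
        rw [← h9] at hx hy
        rw [hc₂ x hx, hc₂ y hy] at hxy
        have := hb₂ x hx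
        have := hb₂ y hy
        have := hm.order.inj _ (by omega) _ (by omega) hxy
        exact hinj₂ x hx y hy (by omega)
      · intro x hx y hy hxy
        rw [← h9] at hy
        rw [hc₁ x hx, hc₂ y hy] at hxy
        have := hb₁ x hx
        have := hb₂ y hy
        exact hne x hx y hy (hm.order.inj _ (by omega) _ (by omega) hxy)
      · exact fun x hx y hy => hno x hx y (h9 ▸ hy)
    · rw [hc₁ _ h12, hc₂ _ h13] at hadj
      exact .inr ⟨h11, h12, h13, hadj⟩

/-- After a hole has been found, `s` is increased. -/
theorem run_increment (hW : n * n + n + 2 ≤ W) (hn : 3 ≤ n) (hm : Inv G k m) (hk : k ≤ n)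
    (hs : 2 * m.var 2 ≤ k) (hh : HoleStored G k (m.var 2) (m.arr 1) (m.arr 2)) :
    Run W (.assign 2 (.add (.var 2) (.lit 1))) m fun t m' => t ≤ 4 ∧ Inv G k m' ∧
      potential G k m' < potential G k m := by
  have hnn : 3 * n ≤ n * n := Nat.mul_le_mul_right n hn
  refine run_assign ?_ ⟨by simp [Exp.cost], ⟨hm.input.setVar (by decide) _, hm.order,
    hm.k_eq, ?_, ?_, ?_⟩, ?_⟩
  · simp only [Exp.Fits, Exp.eval]; omega
  · simp [Exp.eval]
  · simp [Exp.eval]; omega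
  · intro i hi his
    simp only [Exp.eval, Mem.setVar_var, if_true] at his
    rcases Nat.lt_succ_iff_lt_or_eq.1 his with his | rfl
    · exact hm.holes i hi his
    · exact hh
  · simp [potential, Exp.eval]; omega

/-- After an exchange, the invariant still holds. -/
theorem Inv.of_order {m' : Mem} {c : Cmd} (hm : Inv G k m) (hF : Frame c m m')
    (hv : ∀ x < 3, x ∉ c.vars) (ha : ∀ a < 3, a ∉ c.arrs) (ho : IsOrdering n (m'.arr 5)) :
    Inv G k m' := by
  refine ⟨hm.input.frame hF (hv 0 (by decide)) (ha 0 (by decide)), ho, ?_, ?_, ?_, ?_⟩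
  · rw [hF.1 1 (hv 1 (by decide)), hm.k_eq]
  · rw [hF.1 2 (hv 2 (by decide))]; exact hm.s_pos
  · rw [hF.1 2 (hv 2 (by decide))]; exact hm.s_le
  · rw [hF.1 2 (hv 2 (by decide)), hF.2 1 (ha 1 (by decide)), hF.2 2 (ha 2 (by decide))]
    exact hm.holes

end
section

variable {n W k : ℕ} {G : SimpleGraph (Fin n)} {m : Mem}

theorem run_stepLe (hW : n * n + n + 2 ≤ W) (hn : 3 ≤ n) (hm : Prepared G k m) (hk : k ≤ n)
    (hle : m.arr 3 (m.var 2 - 1) ≤ m.arr 4 (m.var 10)) :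
    Run W stepLe m fun t m' => t ≤ 400 * (n * n) ∧ Inv G k m' ∧
      potential G k m' < potential G k m := by
  have hnn : 3 * n ≤ n * n := Nat.mul_le_mul_right n hn
  obtain ⟨hI, hgap, hs, h9, ⟨c, hc, hl₃⟩, hc', hl₄⟩ := hm
  have hpos := hI.s_pos
  have hcn := hl₄.count_le
  -- All early neighbours of `f 0` come before all late neighbours of `f (n - 1)`.
  have hle' : ∀ x < m.var 2, ∀ y < m.var 9, m.arr 3 x ≤ m.arr 4 (m.var 10 + y) := fun x hx y hy =>
    (hl₃.mono_le (show x ≤ m.var 2 - 1 by omega) (by omega)).trans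
      (hle.trans (hl₄.mono_le (by omega) (by omega)))
  have hb₃ : ∀ x < m.var 2, 0 < m.arr 3 x ∧ m.arr 3 x < n - 1 := fun x hx =>
    hl₃.pos_lt hgap (.inl rfl) (by omega)
  have hb₄ : ∀ y < m.var 9, 0 < m.arr 4 (m.var 10 + y) ∧ m.arr 4 (m.var 10 + y) < n - 1 :=
    fun y hy => hl₄.pos_lt hgap (.inr rfl) (by omega)
  refine run_seq ((run_searchHole hW hn hI hk hs h9 (by decide) (by decide) (by decide) (by omega)
    hb₃ (fun x hx y hy => hl₃.inj (by omega) (by omega)) hb₄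
    (fun x hx y hy h => by have := hl₄.inj (by omega) (by omega) h; omega) ?_).mono ?_)
  · intro x hx y hy
    have := hle' x hx y hy
    have := hb₃ x hx
    omega
  rintro t₁ m₁ hF₁ ⟨ht₁, hI₁, h₁⟩
  have a3 : m₁.arr 3 = m.arr 3 := hF₁.2 3 (by decide)
  have a4 : m₁.arr 4 = m.arr 4 := hF₁.2 4 (by decide)
  have a5 : m₁.arr 5 = m.arr 5 := hF₁.2 5 (by decide)
  have v2 : m₁.var 2 = m.var 2 := hF₁.1 2 (by decide)
  have v10 : m₁.var 10 = m.var 10 := hF₁.1 10 (by decide)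
  have hpot : potential G k m₁ = potential G k m := by simp only [potential, a5, v2]
  refine run_cond ?_ (fun h11 => ?_) fun h11 => ?_
  · simp only [Exp.Fits]
    omega
  · simp only [Exp.eval] at h11
    obtain ⟨-, h12, h13, hadj⟩ := h₁.resolve_left fun h => h11 h.1
    set I := m.arr 3 (m₁.var 12) with hIdef
    set J := m.arr 4 (m.var 10 + m₁.var 13) with hJdef
    have hIb := hb₃ _ h12
    have hJb := hb₄ _ h13
    have hIJ := hle' _ h12 _ h13
    rw [show J + 2 - 1 = J + 1 by omega] at hadj
    refine run_seq ((run_reverseCmd hW hn hI₁.order (l := 0) (h := I - 1) ?_ ?_ (by omega)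
      (by omega) (fun v => by simp [Exp.Fits, Exp.eval]) (by simp [Exp.cost])).mono ?_)
    · simp only [Exp.Fits, Exp.eval, a3]; omega
    · simp only [Exp.eval, a3]; rfl
    rintro t₂ m₂ hF₂ ⟨ht₂, he₂, ho₂⟩
    have hI₂ := hI₁.of_order hF₂ (by decide) (by decide) ho₂
    have b4 : m₂.arr 4 = m.arr 4 := (hF₂.2 4 (by decide)).trans a4
    have w10 : m₂.var 10 = m.var 10 := (hF₂.1 10 (by decide)).trans v10
    have w13 : m₂.var 13 = m₁.var 13 := hF₂.1 13 (by decide)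
    refine (run_reverseCmd hW hn ho₂ (l := J + 1) (h := n - 1) ?_ ?_ (by omega)
      (by omega) (fun v => ?_) (by simp [Exp.cost])).mono ?_
    · simp only [Exp.Fits, hI₂.input.var]; omega
    · simp only [Exp.eval, hI₂.input.var]
    · simp [Exp.Fits, Exp.eval, b4, w10, w13, ← hJdef]; omega
    rintro t₃ m₃ hF₃ ⟨ht₃, he₃, ho₃⟩
    refine ⟨by simp only [Exp.cost]; omega, hI₂.of_order hF₃ (by decide) (by decide) ho₃, ?_⟩
    have key := cycleGaps_exchange_le (R := G.NatAdj) (n := n) (i := I) (j := J)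
      (fun _ _ => SimpleGraph.NatAdj.symm) (m.arr 5) hIb.1
      hIJ hJb.2 hgap (hl₃.adj _ (by omega)) (hl₄.adj _ (by omega)) hadj
    have w2 : m₃.var 2 = m.var 2 := (hF₃.1 2 (by decide)).trans ((hF₂.1 2 (by decide)).trans v2)
    simp only [potential, he₃, he₂, a5, w2]
    omega
  · simp only [Exp.eval] at h11
    have hh := (h₁.resolve_right fun h => by omega).2
    refine (run_increment hW hn hI₁ hk (by omega) (v2 ▸ hh)).mono ?_
    rintro t₂ m₂ - ⟨ht₂, hI₂, hp₂⟩
    exact ⟨by simp only [Exp.cost]; omega, hI₂, hpot ▸ hp₂⟩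

theorem run_stepLt (hW : n * n + n + 2 ≤ W) (hn : 3 ≤ n) (hm : Prepared G k m) (hk : k ≤ n)
    (hlt : m.arr 4 (m.var 10) < m.arr 3 (m.var 2 - 1)) :
    Run W stepLt m fun t m' => t ≤ 400 * (n * n) ∧ Inv G k m' ∧
      potential G k m' < potential G k m := by
  have hnn : 3 * n ≤ n * n := Nat.mul_le_mul_right n hn
  obtain ⟨hI, hgap, hs, h9, ⟨c, hc, hl₃⟩, hc', hl₄⟩ := hm
  have hpos := hI.s_pos
  have hcn := hl₄.count_le
  -- The first `s` neighbours of `f (n - 1)` come before the neighbours of `f 0` from the `s`-th on.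
  have hlt' : ∀ x < m.var 2, ∀ y < m.var 9, m.arr 4 x < m.arr 3 (m.var 2 - 1 + y) :=
    fun x hx y hy => (hl₄.mono_le (show x ≤ m.var 10 by omega) (by omega)).trans_lt
      (hlt.trans_le (hl₃.mono_le (by omega) (by omega)))
  have hb₄ : ∀ x < m.var 2, 0 < m.arr 4 x ∧ m.arr 4 x < n - 1 := fun x hx =>
    hl₄.pos_lt hgap (.inr rfl) (by omega)
  have hb₃ : ∀ y < m.var 9, 0 < m.arr 3 (m.var 2 - 1 + y) ∧ m.arr 3 (m.var 2 - 1 + y) < n - 1 :=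
    fun y hy => hl₃.pos_lt hgap (.inl rfl) (by omega)
  refine run_seq (run_assign (by simp only [Exp.Fits]; omega) ?_)
  set m₀ := m.setVar 10 ((Exp.sub (.var 2) (.lit 1)).eval m) with hm₀
  have hI₀ : Inv G k m₀ := ⟨hI.input.setVar (by decide) _, hI.order, hI.k_eq, hI.s_pos, hI.s_le,
    hI.holes⟩
  have u2 : m₀.var 2 = m.var 2 := rfl
  have u9 : m₀.var 9 = m.var 9 := rfl
  have u10 : m₀.var 10 = m.var 2 - 1 := rfl
  have ua : m₀.arr = m.arr := rfl
  refine run_seq ((run_searchHole hW hn hI₀ hk hs h9 (src₁ := 4) (src₂ := 3) (sh := 0) (by decide)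
    (by decide) (by decide) (by omega) hb₄ (fun x hx y hy => hl₄.inj (by omega) (by omega)) hb₃
    (fun x hx y hy h => ?_) ?_).mono ?_)
  · have := hl₃.inj (by omega) (by omega) h
    omega
  · intro x hx y hy
    rw [u2] at hx
    rw [u9] at hy
    have := hlt' x hx y hy
    have := hb₄ x hx
    rw [u10, ua]
    omega
  rintro t₁ m₁ hF₁ ⟨ht₁, hI₁, h₁⟩
  rw [ua, u2, u9, u10] at h₁
  have a3 : m₁.arr 3 = m.arr 3 := hF₁.2 3 (by decide)
  have a4 : m₁.arr 4 = m.arr 4 := hF₁.2 4 (by decide)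
  have a5 : m₁.arr 5 = m.arr 5 := hF₁.2 5 (by decide)
  have v2 : m₁.var 2 = m.var 2 := hF₁.1 2 (by decide)
  have v10 : m₁.var 10 = m.var 2 - 1 := hF₁.1 10 (by decide)
  have hpot : potential G k m₁ = potential G k m := by simp only [potential, a5, v2]
  refine run_cond ?_ (fun h11 => ?_) fun h11 => ?_
  · simp only [Exp.Fits]
    omega
  · simp only [Exp.eval] at h11
    obtain ⟨-, h12, h13, hadj⟩ := h₁.resolve_left fun h => h11 h.1
    set J := m.arr 4 (m₁.var 12) with hJdef
    set I := m.arr 3 (m.var 2 - 1 + m₁.var 13) with hIdef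
    have hIb := hb₃ _ h13
    have hJb := hb₄ _ h12
    have hIJ := hlt' _ h12 _ h13
    rw [Nat.add_zero] at hadj
    refine run_seq ((run_reverseCmd hW hn hI₁.order (l := J) (h := I - 1) ?_ ?_ (by omega)
      (by omega) (fun v => ?_) (by simp [Exp.cost])).mono ?_)
    · simp only [Exp.Fits, Exp.eval, a3, v10]; omega
    · simp only [Exp.eval, a3, v10]; rfl
    · simp [Exp.Fits, Exp.eval, a4, ← hJdef]; omega
    rintro t₂ m₂ hF₂ ⟨ht₂, he₂, ho₂⟩
    have hI₂ := hI₁.of_order hF₂ (by decide) (by decide) ho₂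
    have b3 : m₂.arr 3 = m.arr 3 := (hF₂.2 3 (by decide)).trans a3
    have w10 : m₂.var 10 = m.var 2 - 1 := (hF₂.1 10 (by decide)).trans v10
    have w13 : m₂.var 13 = m₁.var 13 := hF₂.1 13 (by decide)
    refine (run_reverseCmd hW hn ho₂ (l := I) (h := n - 1) ?_ ?_ (by omega)
      (by omega) (fun v => ?_) (by simp [Exp.cost])).mono ?_
    · simp only [Exp.Fits, hI₂.input.var]; omega
    · simp only [Exp.eval, hI₂.input.var]
    · simp [Exp.Fits, Exp.eval, b3, w10, w13, ← hIdef]; omega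
    rintro t₃ m₃ hF₃ ⟨ht₃, he₃, ho₃⟩
    refine ⟨by simp only [Exp.cost]; omega, hI₂.of_order hF₃ (by decide) (by decide) ho₃, ?_⟩
    have key := cycleGaps_exchange_lt (R := G.NatAdj) (n := n) (i := I) (j := J)
      (fun _ _ => SimpleGraph.NatAdj.symm) (m.arr 5) hJb.1
      hIJ hIb.2.le hgap (hl₃.adj _ (by omega)) (hl₄.adj _ (by omega)) hadj
    have w2 : m₃.var 2 = m.var 2 := (hF₃.1 2 (by decide)).trans ((hF₂.1 2 (by decide)).trans v2)
    simp only [potential, he₃, he₂, a5, w2]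
    omega
  · simp only [Exp.eval] at h11
    have hh := (h₁.resolve_right fun h => by omega).2
    refine (run_increment hW hn hI₁ hk (by omega) (v2 ▸ hh)).mono ?_
    rintro t₂ m₂ - ⟨ht₂, hI₂, hp₂⟩
    exact ⟨by simp only [Exp.cost]; omega, hI₂, hpot ▸ hp₂⟩

theorem run_step [DecidableRel G.Adj] (hW : n * n + n + 2 ≤ W) (hn : 3 ≤ n)
    (hm : Inv G (G.minDegree + 1) m) (hs : 2 * m.var 2 ≤ G.minDegree + 1) (h17 : m.var 17 < n)
    (hgap : ¬ G.NatAdj (m.arr 5 (m.var 17)) (m.arr 5 ((m.var 17 + 1) % n))) :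
    Run W step m fun t m' => t ≤ 700 * (n * n) ∧ Inv G (G.minDegree + 1) m' ∧
      potential G (G.minDegree + 1) m' < potential G (G.minDegree + 1) m := by
  have hnn : 3 * n ≤ n * n := Nat.mul_le_mul_right n hn
  have hk : G.minDegree < n := by
    have : Nonempty (Fin n) := ⟨⟨0, by omega⟩⟩
    simpa using G.minDegree_lt_card
  refine run_seq ((run_prepare hW hn hm hs h17 hgap).mono ?_)
  rintro t₁ m₁ - ⟨ht₁, hP, hpot⟩
  obtain ⟨c, hc, hl₃⟩ := hP.lists_first
  have hl₄ := hP.lists_last.2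
  have hpos := hP.s_pos
  have hhalf := hP.s_le_half
  have h9 := hP.var_nine
  have hc₄ := hl₄.count_le
  have hc₃ := hl₃.count_le
  have hb₃ := hl₃.lt (m₁.var 2 - 1) (by omega)
  have hb₄ := hl₄.lt (m₁.var 10) (by omega)
  refine run_cond ?_ (fun h => ?_) fun h => ?_
  · simp only [Exp.Fits, Exp.eval]; omega
  · refine (run_stepLt hW hn hP (by omega) (Exp.lt_eval_ne_zero.1 h)).mono ?_
    rintro t₂ m₂ - ⟨ht₂, hI₂, hp₂⟩
    exact ⟨by simp only [Exp.cost]; omega, hI₂, hpot ▸ hp₂⟩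
  · refine (run_stepLe hW hn hP (by omega) (Exp.lt_eval_eq_zero.1 h)).mono ?_
    rintro t₂ m₂ - ⟨ht₂, hI₂, hp₂⟩
    exact ⟨by simp only [Exp.cost]; omega, hI₂, hpot ▸ hp₂⟩

/-! ### The algorithm -/

/-- Stop with the answer `var 4 = 1` if there is no gap, and with `var 4 = 0` if all holes have
been found. -/
def round : Cmd :=
  .seq findGap (.cond (.lt (.var 17) (.var 0))
    (.cond (.lt (.var 1) (.add (.var 2) (.var 2))) (.assign 3 (.lit 0)) step)
    (.seq (.assign 3 (.lit 0)) (.assign 4 (.lit 1))))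

/-- Start with the order `0, …, n - 1`; as long as `var 3` is not `0`, run a round. -/
def search : Cmd :=
  .seq initOrder (.seq computeMinDegree (.seq (.assign 2 (.lit 1)) (.seq (.assign 3 (.lit 1))
    (.loop (.var 3) round))))

/-- The whole algorithm: search, and copy the order to the output array `1` if it has no gap. The
holes are already in place, in the cells from `n` on. -/
def hamiltonOrHoles : Cmd :=
  .seq search (.seq (.cond (.var 4) (.for 5 0 (.store 1 (.var 5) (ordExp (.var 5)))) .skip)
    (.assign 0 (.var 4)))

/-- The answer `var 4` of the search is right: there is no gap, or all holes have been found. -/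
def Finished (G : SimpleGraph (Fin n)) (k : ℕ) (m : Mem) : Prop :=
  (m.var 4 = 1 ∧ ∀ p < n, G.NatAdj (m.arr 5 p) (m.arr 5 ((p + 1) % n))) ∨
    (m.var 4 = 0 ∧ k / 2 < m.var 2)

theorem run_round [DecidableRel G.Adj] (hW : n * n + n + 2 ≤ W) (hn : 3 ≤ n)
    (hm : Inv G (G.minDegree + 1) m) (h3 : m.var 3 = 1) (h4 : m.var 4 = 0) :
    Run W round m fun t m' => t ≤ 800 * (n * n) ∧ Inv G (G.minDegree + 1) m' ∧
      ((m'.var 3 = 1 ∧ m'.var 4 = 0 ∧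
          potential G (G.minDegree + 1) m' < potential G (G.minDegree + 1) m) ∨
        (m'.var 3 = 0 ∧ Finished G (G.minDegree + 1) m')) := by
  have hnn : 3 * n ≤ n * n := Nat.mul_le_mul_right n hn
  have hk : G.minDegree < n := by
    have : Nonempty (Fin n) := ⟨⟨0, by omega⟩⟩
    simpa using G.minDegree_lt_card
  refine run_seq ((run_findGap hW hn hm.input hm.order).mono ?_)
  rintro t₁ m₁ hF₁ ⟨ht₁, h₁⟩
  have a5 : m₁.arr 5 = m.arr 5 := hF₁.2 5 (by decide)
  have hI₁ := hm.of_order hF₁ (by decide) (by decide) (a5 ▸ hm.order)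
  have v3 : m₁.var 3 = 1 := (hF₁.1 3 (by decide)).trans h3
  have v4 : m₁.var 4 = 0 := (hF₁.1 4 (by decide)).trans h4
  have v2 : m₁.var 2 = m.var 2 := hF₁.1 2 (by decide)
  have v0 := hI₁.input.var
  have v1 := hI₁.k_eq
  have hs := hI₁.s_le
  have hpot : potential G (G.minDegree + 1) m₁ = potential G (G.minDegree + 1) m := by
    simp only [potential, a5, v2]
  rw [← a5] at h₁
  refine run_cond ?_ (fun h => ?_) fun h => ?_
  · simp only [Exp.Fits]
    rcases h₁ with h₁ | h₁ <;> omega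
  · have hlt : m₁.var 17 < n := v0 ▸ Exp.lt_eval_ne_zero.1 h
    obtain ⟨h17, hgap⟩ := h₁.resolve_left fun h => by omega
    refine run_cond (by simp only [Exp.Fits, Exp.eval]; omega) (fun h' => ?_) fun h' => ?_
    · have h' : m₁.var 1 < m₁.var 2 + m₁.var 2 := Exp.lt_eval_ne_zero.1 h'
      refine run_assign (by simp [Exp.Fits]) ⟨by simp only [Exp.cost]; omega,
        ⟨hI₁.input.setVar (by decide) _, hI₁.order, hI₁.k_eq, hI₁.s_pos, hI₁.s_le, hI₁.holes⟩,
        .inr ⟨rfl, .inr ⟨v4, ?_⟩⟩⟩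
      change (G.minDegree + 1) / 2 < m₁.var 2
      omega
    · have h' : m₁.var 2 + m₁.var 2 ≤ m₁.var 1 := Exp.lt_eval_eq_zero.1 h'
      refine (run_step hW hn hI₁ (by omega) h17 hgap).mono ?_
      rintro t₂ m₂ hF₂ ⟨ht₂, hI₂, hp₂⟩
      exact ⟨by simp only [Exp.cost]; omega, hI₂, .inl ⟨(hF₂.1 3 (by decide)).trans v3,
        (hF₂.1 4 (by decide)).trans v4, hpot ▸ hp₂⟩⟩
  · have hge : n ≤ m₁.var 17 := v0 ▸ Exp.lt_eval_eq_zero.1 h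
    obtain ⟨h17, hall⟩ := h₁.resolve_right fun h => by omega
    refine run_seq (run_assign (by simp [Exp.Fits]) (run_assign (by simp only [Exp.Fits]; omega)
      ⟨by simp only [Exp.cost]; omega, ⟨(hI₁.input.setVar (by decide) _).setVar (by decide) _,
        hI₁.order, hI₁.k_eq, hI₁.s_pos, hI₁.s_le, hI₁.holes⟩, .inr ⟨rfl, .inl ⟨rfl, hall⟩⟩⟩))

/-- At most `2 * n + 3` evaluations of the loop condition, each followed by a round of time
`O(n ^ 2)`. -/
theorem run_search [DecidableRel G.Adj] (hW : n * n + n + 2 ≤ W) (hn : 3 ≤ n) :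
    Run W search (graphInput G) fun t m' => t ≤ 3000 * (n * (n * n)) ∧
      Inv G (G.minDegree + 1) m' ∧ Finished G (G.minDegree + 1) m' := by
  have hnn : 3 * n ≤ n * n := Nat.mul_le_mul_right n hn
  have hnnn : 3 * (n * n) ≤ n * (n * n) := Nat.mul_le_mul_right _ hn
  have hk : G.minDegree < n := by
    have : Nonempty (Fin n) := ⟨⟨0, by omega⟩⟩
    simpa using G.minDegree_lt_card
  have hin := holdsInput_graphInput G
  refine run_seq ((run_initOrder hW hn hin (by simp [graphInput])).mono ?_)
  rintro t₁ m₁ hF₁ ⟨ht₁, ho₁⟩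
  have hin₁ : HoldsInput G m₁ := hin.frame hF₁ (by decide) (by decide)
  refine run_seq ((run_computeMinDegree hW hn hin₁ ho₁).mono ?_)
  rintro t₂ m₂ hF₂ ⟨ht₂, h1⟩
  have hin₂ : HoldsInput G m₂ := hin₁.frame hF₂ (by decide) (by decide)
  have ho₂ : IsOrdering n (m₂.arr 5) := by rw [hF₂.2 5 (by decide)]; exact ho₁
  have h4 : m₂.var 4 = 0 := by
    rw [hF₂.1 4 (by decide), hF₁.1 4 (by decide)]; simp [graphInput]
  refine run_seq (run_assign (by simp only [Exp.Fits]; omega) (run_seq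
    (run_assign (by simp only [Exp.Fits]; omega) ?_)))
  -- Initially there are at most `n` gaps, and `k + 2 - s ≤ n + 1`, so the potential is
  -- below `2 * n + 2`.
  refine (run_loop (B := 800 * (n * n)) (fun v m => Inv G (G.minDegree + 1) m ∧
    ((m.var 3 = 1 ∧ m.var 4 = 0 ∧ potential G (G.minDegree + 1) m < v) ∨
      (m.var 3 = 0 ∧ Finished G (G.minDegree + 1) m))) ?_ (2 * n + 2) _ ?_).mono ?_
  · rintro v m ⟨hI, h⟩
    refine ⟨by simp only [Exp.Fits]; omega, fun h3 => ?_⟩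
    obtain ⟨h3, h4, hp⟩ := h.resolve_right fun h => h3 h.1
    refine (run_round hW hn hI h3 h4).mono ?_
    rintro t m' - ⟨ht, hI', h'⟩
    refine ⟨ht, potential G (G.minDegree + 1) m, hp, hI', h'⟩
  · refine ⟨⟨(hin₂.setVar (by decide) _).setVar (by decide) _, ho₂, h1, ?_, ?_, ?_⟩,
      .inl ⟨rfl, h4, ?_⟩⟩
    · simp [Exp.eval]
    · simp [Exp.eval]
    · intro i hi hi'
      simp [Exp.eval] at hi'
      omega
    · have := cycleGaps_le (R := G.NatAdj) n (by omega) (m₂.arr 5)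
      simp [potential, Exp.eval]
      omega
  · rintro t m' - ⟨ht, h3, v, hI, h⟩
    refine ⟨?_, hI, (h.resolve_left fun h => by simp [Exp.eval, h.1] at h3).2⟩
    simp only [Exp.cost] at ht ⊢
    nlinarith

theorem run_hamiltonOrHoles [DecidableRel G.Adj] (hW : n * n + n + 2 ≤ W) (hn : 3 ≤ n) :
    Run W hamiltonOrHoles (graphInput G) fun t m => t ≤ 3100 * (n * (n * n)) ∧
      ((m.var 0 = 1 ∧ HoldsHamiltonCycle G m) ∨
        (m.var 0 = 0 ∧ HoldsHoleCertificate G (G.minDegree + 1) m)) := by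
  have hnn : 3 * n ≤ n * n := Nat.mul_le_mul_right n hn
  have hnnn : 3 * (n * n) ≤ n * (n * n) := Nat.mul_le_mul_right _ hn
  refine run_seq ((run_search hW hn).mono ?_)
  rintro t₁ m₁ - ⟨ht₁, hI, hfin⟩
  refine run_seq (run_cond ?_ (fun h => ?_) fun h => ?_)
  · simp only [Exp.Fits]
    rcases hfin with h | h <;> omega
  · obtain ⟨h4, hall⟩ := hfin.resolve_right fun h' => h h'.1
    refine (run_for (N := n) (B := 4) (fun i m => ∀ p < i, m.arr 1 p = m₁.arr 5 p) (by omega)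
      hI.input.var (by decide) (by decide) (by decide) (fun i m v h => h) (by simp) ?_).mono ?_
    · intro i m hi hx hF h
      have a5 : m.arr 5 = m₁.arr 5 := hF.2 5 (by decide)
      have := hI.order.lt i
      refine run_store (by simp only [Exp.Fits]; omega) ?_ ⟨by simp [Exp.cost, ordExp], ?_⟩
      · simp only [ordExp, Exp.Fits, Exp.eval, hx, a5]; omega
      · intro p hp
        simp only [ordExp, Exp.eval, hx, a5, Mem.setArr_arr, if_true]
        rcases Nat.lt_succ_iff_lt_or_eq.1 hp with hp | rfl
        · rw [Function.update_of_ne hp.ne, h p hp]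
        · rw [Function.update_self]
    · rintro t₂ m₂ hF₂ ⟨ht₂, hc⟩
      have v4 : m₂.var 4 = 1 := (hF₂.1 4 (by decide)).trans h4
      refine run_assign (by simp only [Exp.Fits]; omega) ⟨by simp only [Exp.cost]; omega, .inl
        ⟨by simp [Exp.eval, v4], ?_⟩⟩
      obtain ⟨a, p, hp, hv⟩ := hI.order.exists_isHamiltonianCycle hn hall
      exact ⟨a, p, hp, fun i hi => (hc i hi).trans (hv i hi)⟩
  · obtain ⟨h4, hs⟩ := hfin.resolve_left fun h' => by
      simp [Exp.eval, h'.1] at h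
    refine run_skip (run_assign (by simp only [Exp.Fits]; omega) ⟨by simp only [Exp.cost]; omega,
      .inr ⟨by simp [Exp.eval, h4], holdsHoleCertificate_of_holeStored hI.k_eq
        fun i hi hik => hI.holes i hi (by omega)⟩⟩)

end
end RAM

theorem mainTheorem3 :
    ∃ (P : RAM.Cmd) (C d : ℕ), ∀ (n : ℕ), 3 ≤ n →
      ∀ (G : SimpleGraph (Fin n)) [DecidableRel G.Adj],
        ∃ (t : ℕ) (m : RAM.Mem),
          RAM.Exec (n ^ d) P (RAM.graphInput G) t m ∧
          t ≤ C * n ^ 3 ∧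
          ((m.var 0 = 1 ∧ RAM.HoldsHamiltonCycle G m) ∨
            (m.var 0 = 0 ∧ RAM.HoldsHoleCertificate G (G.minDegree + 1) m ∧
              G.minDegree < bipartiteHoleNumber G)) := by
  refine ⟨RAM.hamiltonOrHoles, 3100, 3, fun n hn G _ => ?_⟩
  have hW : n * n + n + 2 ≤ n ^ 3 := by nlinarith [Nat.mul_le_mul_right (n * n) hn]
  obtain ⟨t, m, hE, ht, h⟩ := RAM.run_hamiltonOrHoles (G := G) hW hn
  refine ⟨t, m, hE, by linarith [show n ^ 3 = n * (n * n) by ring], h.imp id fun h => ?_⟩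
  obtain ⟨-, S, T, hST, -⟩ := h.2
  exact ⟨h.1, h.2, hST.le_bipartiteHoleNumber⟩
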